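/- \textbf{Setting.} Let $\mathcal X,\mathcal U$ be Borel spaces (Borel subsets of Polish spaces), let $U:\mathcal X\rightrightarrows\mathcal U$ be a measurable multifunction with nonempty values, $Q(\cdot\,|\,x,u)$ a measurable transition kernel from $\mathrm{graph}(U)$ to the probability measures on $\mathcal X$, $c:\mathcal X\times\mathcal U\times\mathcal X\to\mathbb R$ a cost function, and $x_A\in\mathcal X$ an absorbing state: $Q(\{x_A\}|x_A,u)=1$ and $c(x_A,u,x_A)=0$ for $u\in U(x_A)$. Let $P_0$ be a probability measure on $\mathcal X$, $p\in[1,\infty)$, $1/p+1/q=1$, $\mathcal V=L_p(\mathcal X,P_0)$, and let $\mathcal M$ be the set of probability measures $m\ll P_0$ with $dm/dP_0\in L_q(P_0)$, with the weak$^*$ topology (pairing $\langle\varphi,m\rangle=\int\varphi\,dm$, $\varphi\in\mathcal V$). Let $w:\mathcal X\to[1,\infty)$, $w\in\mathcal V$, be a weight function. Let $\sigma:\mathcal V\times\mathcal X\times\mathcal M\to\mathbb R$ be a risk transition mapping: $\sigma$ is measurable and, for all $x,m$, $\sigma(\cdot,x,m)$ is a coherent measure of risk (convex, monotone, $\sigma(a+\varphi,x,m)=a+\sigma(\varphi,x,m)$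 for $a\in\mathbb R$, positively homogeneous). Assume that $\sigma$ is law invariant: $\sigma(\varphi,x,\mu)=\sigma(\psi,x,\nu)$ whenever the distribution of $\varphi$ under $\mu$ equals that of $\psi$ under $\nu$. Put $\mathcal A(x,m)=\partial_\varphi\sigma(0,x,m)\subset\mathcal M$. \textbf{General conditions.} (G0) $Q(\cdot|x,u)\in\mathcal M$ for all $x$ and $u\in U(x)$. (G1) $Q$ is setwise continuous: $(x,u)\mapsto Q(B|x,u)$ is continuous on $\mathrm{graph}(U)$ for every Borel set $B$. (G2) $\mathcal A$ is lower semicontinuous: if $x_k\to x$, $m_k\to m$ weakly$^*$, and a weak$^*$ open set $O$ meets $\mathcal A(x,m)$, then $O$ meets $\mathcal A(x_k,m_k)$ for all large $k$. (G3) $c$ is measurable; $|c(x,u,y)|\le C(w(x)+w(y))$ for some constant $C$ and all $x$, $u\in U(x)$, $y$; and $c(\cdot,\cdot,y)$ is lower semicontinuous on $\mathrm{graph}(U)$ for every $y$. (G4) $U$ is compact-valued. \textbf{Policies and risk.} A deterministic policy $\Lambda=\{\lambda_1,\lambda_2,\dots\}$ chooses at time $t$ a control $\lambda_t(x_1,\dots,x_t)\in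 U(x_t)$, measurably in the history. It is Markov if $\lambda_t$ depends on $x_t$ only, and stationary Markov if moreover $\lambda_t=\pi$ for all $t$. With the one-step conditional risk measures $[\rho_t^\Lambda Z](x_1,\dots,x_t)=\sigma\big(Z(x_1,\dots,x_t,\cdot),x_t,Q(\cdot|x_t,u_t)\big)$, where $u_t=\lambda_t(x_1,\dots,x_t)$, put $$J_T(\Lambda,x_1)=\rho_1^\Lambda\Big(c(x_1,u_1,x_2)+\rho_2^\Lambda\big(c(x_2,u_2,x_3)+\cdots+\rho_T^\Lambda(c(x_T,u_T,x_{T+1}))\cdots\big)\Big),$$ $J_\infty(\Lambda,x)=\liminf_{T\to\infty}J_T(\Lambda,x)$, $\hat J(x)=\inf_\Lambda J_\infty(\Lambda,x)$ over all deterministic policies, and $J^*(x)=\inf J_\infty(\Lambda,x)$ over the stationary deterministic Markov policies. \textbf{Uniform risk-transience.} Put $\widetilde{\mathcal X}=\mathcal X\setminus\{x_A\}$. For a decision rule $\pi$ (a measurable selector of $U$) let $\widetilde{\mathfrak M}^\pi(x)$, $x\in\widetilde{\mathcal X}$, be the set of restrictions to $\widetilde{\mathcal X}$ of the measures in $\mathcal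 A(x,Q(\cdot|x,\pi(x)))$. Write $M\lessdot\mathfrak M$ if $M$ is a kernel with $M(x)\in\mathfrak M(x)$ for all $x$. Multikernels are composed by $[\mathfrak M_1\mathfrak M_2](x)=\{[M_1M_2](x):M_i\lessdot\mathfrak M_i\}$, where $[M_1M_2](B|x)=\int M_2(B|y)\,M_1(dy|x)$, and are added as Minkowski sums. For a kernel $A$ on $\widetilde{\mathcal X}$ let $\|A\|_w=\sup_{x\in\widetilde{\mathcal X}}w(x)^{-1}\int_{\widetilde{\mathcal X}}w(y)\,A(dy|x)$. The model is uniformly risk-transient if there is a constant $K$ such that $\|M\|_w\le K$ for all decision rules $\pi$, all $T\ge0$ and all $M\lessdot\sum_{j=1}^T(\widetilde{\mathfrak M}^\pi)^j$. \textbf{Proposition (value iteration).} Assume (G0)--(G4), that $\sigma(\cdot,x,\cdot)$ is (sequentially) continuous on $\mathcal V\times\mathcal M$ for every $x$ (norm topology on $\mathcal V$), that $c(x,u,y)\ge0$ for all $x$, $u\in U(x)$, $y$, and that the model is uniformly risk-transient. Let $$[\mathfrak Dv](x)=\min_{u\in U(x)}\sigma\big(c(x,u,\cdot)+v(\cdot),x,Q(\cdot|x,u)\big),\qquad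 v^0=0,\quad v^{k+1}=\mathfrak Dv^k .$$ Then all functions to which $\sigma$ is applied in the definitions of $J_T(\Lambda,\cdot)$ lie in $\mathcal V$; every $v^k$ is measurable and lies in $\mathcal V$; the minima defining $v^{k+1}$ are attained; and $$\hat J(x)=\lim_{k\to\infty}v^k(x),\qquad x\in\mathcal X .$$ Moreover $\hat J$ is real-valued, measurable, and lies in $\mathcal V$, and $\hat J=J^*$; in particular $\hat J$ is also the infimum of $J_\infty$ over all (non-stationary) deterministic Markov policies. -/

import Mathlib

open MeasureTheory ProbabilityTheory Filter Topology Set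
open scoped ENNReal NNReal Pointwise

noncomputable section

namespace RiskMDP

/-! ### The space of probability measures with density in the dual of `L_p` -/

section Measures

variable {X : Type*} [MeasurableSpace X]

/-- The set `𝓜` of probability measures on `X` that lie in the dual of `V = L_p(X, P₀)`:
absolutely continuous with respect to `P₀`, with density in `L_q(X, P₀)`, `1/p + 1/q = 1`. -/
def InDual (p : ℝ≥0∞) (P₀ m : Measure X) : Prop :=
  IsProbabilityMeasure m ∧ m ≪ P₀ ∧
    MemLp (fun y => (m.rnDeriv P₀ y).toReal) (ENNReal.conjExponent p) P₀

/-- `𝓜` as a type. -/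
def DualProb (p : ℝ≥0∞) (P₀ : Measure X) : Type _ := {m : Measure X // InDual p P₀ m}

/-- The weak* topology on `𝓜`: the coarsest one for which `m ↦ ∫ φ dm` is continuous for every
`φ ∈ V`. -/
instance (p : ℝ≥0∞) (P₀ : Measure X) : TopologicalSpace (DualProb p P₀) :=
  TopologicalSpace.induced (fun m (φ : Lp ℝ p P₀) => ∫ y, φ y ∂m.1) inferInstance

end Measures

/-! ### Risk transition mappings -/

section Risk

variable {X : Type*} [MeasurableSpace X] {p : ℝ≥0∞} {P₀ : Measure X}

/-- Coherent measures of risk on `V = L_p(X, P₀)`. -/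
structure IsCoherent [IsFiniteMeasure P₀] (ρ : Lp ℝ p P₀ → ℝ) : Prop where
  convex : ∀ (a : ℝ) (φ ψ : Lp ℝ p P₀), 0 < a → a < 1 →
    ρ (a • φ + (1 - a) • ψ) ≤ a * ρ φ + (1 - a) * ρ ψ
  mono : ∀ φ ψ : Lp ℝ p P₀, φ ≤ ψ → ρ φ ≤ ρ ψ
  translation : ∀ (a : ℝ) (φ : Lp ℝ p P₀), ρ (Lp.const p P₀ a + φ) = a + ρ φ
  pos_homogeneous : ∀ (b : ℝ) (φ : Lp ℝ p P₀), 0 ≤ b → ρ (b • φ) = b * ρ φ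

/-- `σ : V × X × 𝓜 → ℝ` is a risk transition mapping: it is Borel measurable for the product of the
norm topology, the topology of `X` and the weak* topology, and `σ(·, x, m)` is a coherent measure
of risk on `V` for all `x` and `m`. -/
structure IsRiskTransitionMapping [TopologicalSpace X] [IsFiniteMeasure P₀] [Fact (1 ≤ p)]
    (σ : Lp ℝ p P₀ → X → DualProb p P₀ → ℝ) : Prop where
  measurable : Measurable[borel (Lp ℝ p P₀ × X × DualProb p P₀)]
    (fun z : Lp ℝ p P₀ × X × DualProb p P₀ => σ z.1 z.2.1 z.2.2)
  coherent : ∀ x m, IsCoherent (fun φ => σ φ x m)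

/-- Law invariance: `σ(φ, x, m)` depends on `φ` and `m` through the distribution function of `φ`
under `m` only. -/
def LawInvariant (σ : Lp ℝ p P₀ → X → DualProb p P₀ → ℝ) : Prop :=
  ∀ (φ ψ : Lp ℝ p P₀) (μ ν : DualProb p P₀),
    (∀ η : ℝ, μ.1 {y | φ y ≤ η} = ν.1 {y | ψ y ≤ η}) → ∀ x, σ φ x μ = σ ψ x ν

/-- The subdifferential `𝒜(x, m) = ∂_φ σ(0, x, m)`, as a subset of `𝓜` (for a coherent measure of
risk every subgradient at `0` is a probability measure, and `σ(0, x, m) = 0`). -/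
def riskSet (σ : Lp ℝ p P₀ → X → DualProb p P₀ → ℝ) (x : X) (m : DualProb p P₀) :
    Set (DualProb p P₀) :=
  {μ | ∀ φ : Lp ℝ p P₀, σ 0 x m + ∫ y, φ y ∂μ.1 ≤ σ φ x m}

/-- Lower semicontinuity (along sequences) of the multifunction `𝒜` on `X × 𝓜`: if `(x_k, m_k)`
converges to `(x, m)`, then every open set that meets `𝒜(x, m)` meets `𝒜(x_k, m_k)` for all
large `k`. -/
def RiskSetLowerSemicontinuous [TopologicalSpace X]
    (σ : Lp ℝ p P₀ → X → DualProb p P₀ → ℝ) : Prop :=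
  ∀ (x : ℕ → X) (m : ℕ → DualProb p P₀) (x₀ : X) (m₀ : DualProb p P₀),
    Tendsto x atTop (𝓝 x₀) → Tendsto m atTop (𝓝 m₀) →
    ∀ O : Set (DualProb p P₀), IsOpen O → (riskSet σ x₀ m₀ ∩ O).Nonempty →
      ∀ᶠ k in atTop, (riskSet σ (x k) (m k) ∩ O).Nonempty

open Classical in
/-- `σ(φ, x, m)` for a function `φ` on `X` and a measure `m` on `X`. The value `0` is used where
`φ ∉ V` or `m ∉ 𝓜`. -/
def riskEval (σ : Lp ℝ p P₀ → X → DualProb p P₀ → ℝ) (φ : X → ℝ) (x : X) (m : Measure X) : ℝ :=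
  if h : MemLp φ p P₀ ∧ InDual p P₀ m then σ (h.1.toLp φ) x ⟨m, h.2⟩ else 0

end Risk

/-! ### Multikernels -/

section Multikernels

variable {S : Type*} [MeasurableSpace S]

/-- A kernel `M` is a measurable selector of the multikernel `𝔐`. -/
def IsSelector (M : Kernel S S) (𝔐 : S → Set (Measure S)) : Prop := ∀ x, M x ∈ 𝔐 x

/-- Composition of multikernels; `[M₁ M₂](B | x) = ∫ M₂(B | y) M₁(dy | x)`. -/
def multiComp (𝔐₁ 𝔐₂ : S → Set (Measure S)) (x : S) : Set (Measure S) :=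
  {μ | ∃ M₁ M₂ : Kernel S S, IsSelector M₁ 𝔐₁ ∧ IsSelector M₂ 𝔐₂ ∧ μ = (M₂.comp M₁) x}

/-- Powers of a multikernel. -/
def multiPow (𝔐 : S → Set (Measure S)) : ℕ → S → Set (Measure S)
  | 0 => fun x => {Measure.dirac x}
  | 1 => 𝔐
  | n + 2 => multiComp (multiPow 𝔐 (n + 1)) 𝔐

/-- The (Minkowski) sum `∑_{j=1}^T 𝔐^j`. -/
def multiPowSum (𝔐 : S → Set (Measure S)) (T : ℕ) (x : S) : Set (Measure S) :=
  ∑ j ∈ Finset.Icc 1 T, multiPow 𝔐 j x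

/-- The operator norm `‖A‖_w = sup_x (1 / w(x)) ∫ w(y) A(dy | x)`, for `w ≥ 1`. -/
def kernelNorm (w : S → ℝ) (A : Kernel S S) : ℝ≥0∞ :=
  ⨆ x, (∫⁻ y, ENNReal.ofReal (w y) ∂(A x)) / ENNReal.ofReal (w x)

end Multikernels

/-! ### Controlled Markov models -/

/-- A stationary controlled Markov process with an absorbing, cost-free state. -/
structure Model (X 𝒰 : Type*) [MeasurableSpace X] [TopologicalSpace 𝒰] [MeasurableSpace 𝒰] where
  /-- the control sets `U(x)` -/
  U : X → Set 𝒰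
  U_nonempty : ∀ x, (U x).Nonempty
  U_measurable : ∀ O : Set 𝒰, IsOpen O → MeasurableSet {x | (U x ∩ O).Nonempty}
  /-- the controlled transition kernel, on the graph of `U` -/
  Q : Kernel {z : X × 𝒰 // z.2 ∈ U z.1} X
  Q_markov : IsMarkovKernel Q
  /-- the cost `c(x, u, y)` of a transition from `x` to `y` under the control `u` -/
  c : X → 𝒰 → X → ℝ
  /-- the absorbing state -/
  xA : X
  Q_absorbing : ∀ u (hu : u ∈ U xA), Q ⟨(xA, u), hu⟩ {xA} = 1
  c_absorbing : ∀ u ∈ U xA, c xA u xA = 0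

namespace Model

variable {X 𝒰 : Type*} [MeasurableSpace X] [TopologicalSpace 𝒰] [MeasurableSpace 𝒰]
  (D : Model X 𝒰)

/-- Deterministic decision rules: measurable selectors `π` of `U`. -/
structure Rule where
  toFun : X → 𝒰
  measurable : Measurable toFun
  mem : ∀ x, toFun x ∈ D.U x

/-- Deterministic policies. At time `t` (counted from `0`) the control is a measurable function of
the states visited at times `0, …, t`; past controls are functions of past states and need not be
recorded. -/
structure Policy where
  toFun : ∀ t : ℕ, (Fin (t + 1) → X) → 𝒰
  measurable : ∀ t, Measurable (toFun t)
  mem : ∀ t h, toFun t h ∈ D.U (h (Fin.last t))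

variable {D}

/-- The Markov policy given by a sequence of decision rules. -/
def Policy.ofRules (π : ℕ → D.Rule) : D.Policy where
  toFun t h := (π t).toFun (h (Fin.last t))
  measurable t := (π t).measurable.comp (measurable_pi_apply _)
  mem t _ := (π t).mem _

variable (D)

section Risk

variable {p : ℝ≥0∞} {P₀ : Measure X} (σ : Lp ℝ p P₀ → X → DualProb p P₀ → ℝ)

/-- The one-step conditional risk measure `ρ_t` of the policy `Λ`: it maps a function `Z` of the
states up to time `t + 1` to the function `h ↦ σ(Z(h, ·), x_t, Q(x_t, λ_t(h)))` of the states up to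
time `t`. -/
def condRisk (Λ : D.Policy) (t : ℕ) (Z : (Fin (t + 2) → X) → ℝ) (h : Fin (t + 1) → X) : ℝ :=
  riskEval σ (fun y => Z (Fin.snoc h y)) (h (Fin.last t))
    (D.Q ⟨(h (Fin.last t), Λ.toFun t h), Λ.mem t h⟩)

/-- The cost `c(x_t, u_t, x_{t+1})` under the policy `Λ`. -/
def stageCost (Λ : D.Policy) (t : ℕ) (h : Fin (t + 2) → X) : ℝ :=
  D.c (h (Fin.last t).castSucc) (Λ.toFun t (Fin.init h)) (h (Fin.last (t + 1)))

/-- The nested risk of the `n` stage costs from time `t` on: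
`ρ_t(c_t + ρ_{t+1}(c_{t+1} + ⋯ + ρ_{t+n-1}(c_{t+n-1}) ⋯ ))`. -/
def tailRisk (Λ : D.Policy) : (n t : ℕ) → (Fin (t + 1) → X) → ℝ
  | 0, _, _ => 0
  | n + 1, t, h =>
      D.condRisk σ Λ t (fun h' => D.stageCost Λ t h' + tailRisk Λ n (t + 1) h') h

/-- The finite horizon risk `J_T(Λ, x)`. -/
def JT (Λ : D.Policy) (T : ℕ) (x : X) : ℝ := D.tailRisk σ Λ T 0 (fun _ => x)

/-- `J_∞(Λ, x) = liminf_T J_T(Λ, x)`, in the extended reals. -/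
def JInf (Λ : D.Policy) (x : X) : EReal :=
  liminf (fun T : ℕ => ((D.JT σ Λ T x : ℝ) : EReal)) atTop

/-- `Ĵ`: the infimum of `J_∞` over all deterministic policies. -/
def JHat (x : X) : EReal := ⨅ Λ : D.Policy, D.JInf σ Λ x

/-- The infimum of `J_∞` over all (non-stationary) deterministic Markov policies. -/
def JMarkov (x : X) : EReal := ⨅ π : ℕ → D.Rule, D.JInf σ (Policy.ofRules π) x

/-- `J*`: the infimum of `J_∞` over all stationary deterministic Markov policies. -/
def JStar (x : X) : EReal := ⨅ π : D.Rule, D.JInf σ (Policy.ofRules fun _ => π) x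

/-- `σ(c(x, u, ·) + v, x, Q(x, u))` for `u ∈ U(x)`. -/
def stepRisk (v : X → ℝ) (x : X) (u : D.U x) : ℝ :=
  riskEval σ (fun y => D.c x u y + v y) x (D.Q ⟨(x, u), u.2⟩)

/-- The dynamic programming operator `𝔇`. -/
def dpOp (v : X → ℝ) (x : X) : ℝ := ⨅ u : D.U x, D.stepRisk σ v x u

/-- Value iteration: `v⁰ = 0`, `v^{k+1} = 𝔇 v^k`. -/
def valueIter : ℕ → X → ℝ
  | 0 => 0
  | k + 1 => D.dpOp σ (valueIter k)

/-- The effective risk multikernel of a decision rule `π`: for `x ≠ x_A`, the restrictions to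
`X ∖ {x_A}` of the measures in `𝒜(x, Q(x, π(x)))`. -/
def effMultikernel (π : D.Rule) (x : {x : X // x ≠ D.xA}) :
    Set (Measure {x : X // x ≠ D.xA}) :=
  {ν | ∃ m μ : DualProb p P₀, m.1 = D.Q ⟨(x.1, π.toFun x.1), π.mem x.1⟩ ∧
    μ ∈ riskSet σ x.1 m ∧ ν = μ.1.comap Subtype.val}

/-- Uniform risk-transience with weight function `w`. -/
def UniformlyRiskTransient (w : X → ℝ) : Prop :=
  ∃ K : ℝ≥0, ∀ (π : D.Rule) (T : ℕ) (M : Kernel {x : X // x ≠ D.xA} {x : X // x ≠ D.xA}),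
    IsSelector M (multiPowSum (D.effMultikernel σ π) T) →
      kernelNorm (fun x => w x.1) M ≤ (K : ℝ≥0∞)

end Risk

/-! ### The general conditions (G0), (G1), (G3), (G4) -/

/-- Every `Q(x, u)` lies in the dual of `V`. -/
def CondG0 (p : ℝ≥0∞) (P₀ : Measure X) : Prop := ∀ z, InDual p P₀ (D.Q z)

/-- `Q` is setwise continuous (the graph of `U` is metrizable, so that continuity along
sequences is continuity). -/
def CondG1 [TopologicalSpace X] : Prop :=
  ∀ B : Set X, MeasurableSet B → Continuous (fun z => D.Q z B)

/-- `c` is measurable, `w`-bounded, and lower semicontinuous in its first two arguments. -/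
structure CondG3 [TopologicalSpace X] (w : X → ℝ) : Prop where
  measurable : Measurable (fun z : X × 𝒰 × X => D.c z.1 z.2.1 z.2.2)
  bounded : ∃ C : ℝ, 0 < C ∧ ∀ x, ∀ u ∈ D.U x, ∀ y, |D.c x u y| ≤ C * (w x + w y)
  lsc : ∀ y, LowerSemicontinuousOn (fun z : X × 𝒰 => D.c z.1 z.2 y) {z | z.2 ∈ D.U z.1}

/-- `U` is compact-valued (its measurability is part of the model). -/
def CondG4 : Prop := ∀ x, IsCompact (D.U x)

end Model

/-- Weight functions: measurable, with values in `[1, ∞)`, and in `V = L_p(X, P₀)`. -/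
structure IsWeight {X : Type*} [MeasurableSpace X] (p : ℝ≥0∞) (P₀ : Measure X) (w : X → ℝ) :
    Prop where
  measurable : Measurable w
  one_le : ∀ x, 1 ≤ w x
  memLp : MemLp w p P₀

end RiskMDP

end

/-!
The iterates `v^k` increase, and every policy has risk at least `v^k` over `k` periods
(`valueIter_le_tailRisk`), so that `lim v^k ≤ Ĵ`. Conversely let `g = lim v^k`. If `g` is finite and
`𝔇 g ≤ g`, then a decision rule `π` attaining the minima in `𝔇 g` does not increase `g`; as `g ≥ 0`,
the stationary policy `π` has risk at most `g` over every horizon (`tailRisk_ofRules_le`), and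
`J* ≤ g ≤ Ĵ ≤ J*`. This is `exists_value`. It remains to find bounds for the iterates, to attain the
minima measurably, and to pass to the limit in `𝔇`.

*Bounds.* Fix any decision rule and replace the cost by `C (w(x) + w(y))`; the risk of the resulting
problem dominates `v^k`. By the dual representation each one-step risk is a maximum of integrals
over the risk set, and this maximum is attained at a kernel (`exists_kernel_integral_eq`). Hence the
bound for `v^k` is a sum of integrals of `w` with respect to products of selectors of the effective
multikernel, and uniform risk-transience bounds this sum by a multiple of `w`
(`exists_upperBound_le`). The mass that reaches the absorbing state is harmless, since nothing is
paid there. Transience over a single period gives `σ(w, x, Q(x, u)) ≤ K w(x)`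
(`exists_oneStep_weight_le`), which puts the nested risks of every policy into `L_p`.

*The dual representation.* A kernel attaining the maximum comes from a Hahn–Banach theorem with
measurable dependence on a parameter (`exists_measurable_linear_le`): repeated directional
derivatives along a dense sequence turn a sublinear functional into a linear one below it, and each
of them is a countable infimum. The linear functionals obtained are positive and continuous on
`L_p`, hence given by measures with density in `L_q` (`exists_dualProb_of_linear`).

*Semicontinuity.* The minima are attained because `(x, u) ↦ σ(c(x, u, ·) + v, x, Q(x, u))` is lower
semicontinuous (`lowerSemicontinuous_stepRisk`). Lower semicontinuity of the risk sets makes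
`σ(φ, ·, ·)` lower semicontinuous for the weak* topology, but a setwise continuous `Q` need not be
weakly* continuous: its densities may be unbounded in `L_q`. Here law invariance helps. For a simple
function `s` only the masses of the level sets of `s` matter, so `Q(x, u)` may be replaced by its
average over them, which does depend weakly* continuously on `(x, u)`
(`lowerSemicontinuous_oneStep_simple`). Nonnegative functions are increasing limits of simple ones,
and a lower semicontinuous cost is handled by tail infima along a convergent sequence.

*Measurable minimizers.* The minimizers of a lower semicontinuous function over a measurable
compact-valued multifunction form such a multifunction again (`MeasurableCompactMulti.exists_min`);
minimizing the distances to a dense sequence one after the other yields a measurable selector.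

*The limit.* `𝔇 v^k ≤ g` for all `k` gives `𝔇 g ≤ g`, because the compact sets of controls that are
good for `v^k` decrease and thus have a common point (`dpOp_le_of_tendsto`).
-/

/-! ### Measurable minimizers over compact-valued multifunctions -/

theorem LowerSemicontinuousOn.comp_prodMk {X 𝒰 : Type*} [TopologicalSpace X] [TopologicalSpace 𝒰]
    {Φ : X → Set 𝒰} {f : X × 𝒰 → ℝ}
    (hf : LowerSemicontinuousOn f {z | z.2 ∈ Φ z.1}) (x : X) :
    LowerSemicontinuousOn (fun u => f (x, u)) (Φ x) := fun u hu a ha =>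
  ((Continuous.prodMk_right x).continuousWithinAt.tendsto_nhdsWithin
    (t := {z | z.2 ∈ Φ z.1}) fun _ hu => hu).eventually (hf (x, u) hu a ha)

theorem measurable_of_measurable_dist {α β : Type*} [MeasurableSpace α] [PseudoMetricSpace β]
    [MeasurableSpace β] [BorelSpace β] {d : ℕ → β} (hd : DenseRange d) {f : α → β}
    (h : ∀ i, Measurable fun a => dist (f a) (d i)) : Measurable f := by
  refine measurable_of_isOpen fun O hO => ?_
  have : f ⁻¹' O = ⋃ p ∈ {p : ℕ × ℕ | Metric.ball (d p.1) (1 / (p.2 + 1 : ℝ)) ⊆ O},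
      {x | dist (f x) (d p.1) < 1 / (p.2 + 1 : ℝ)} := by
    ext x
    simp only [mem_preimage, mem_iUnion, mem_ofPred_eq, exists_prop]
    constructor
    · intro hx
      obtain ⟨ε, hε, hball⟩ := Metric.isOpen_iff.1 hO _ hx
      obtain ⟨n, hn⟩ := exists_nat_one_div_lt (half_pos hε)
      obtain ⟨i, hi⟩ := hd.exists_dist_lt (f x) (by positivity : (0 : ℝ) < 1 / (n + 1 : ℝ))
      refine ⟨(i, n), fun u hu => hball ?_, hi⟩
      have h1 : dist u (d i) < 1 / (n + 1 : ℝ) := hu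
      rw [Metric.mem_ball]
      linarith [dist_triangle_right u (f x) (d i)]
    · rintro ⟨p, hp, hx⟩
      exact hp hx
  rw [this]
  exact MeasurableSet.biUnion (to_countable _) fun p _ =>
    measurableSet_lt (h p.1) measurable_const

section Selection

variable {X 𝒰 : Type*}
  [TopologicalSpace X] [TopologicalSpace.MetrizableSpace X] [SecondCountableTopology X]
  [MeasurableSpace X] [BorelSpace X]
  [TopologicalSpace 𝒰] [TopologicalSpace.MetrizableSpace 𝒰] [SecondCountableTopology 𝒰]

/-- A multifunction with nonempty compact values that is (weakly) measurable: the set of points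
whose value meets a given open set is measurable. -/
structure MeasurableCompactMulti (Φ : X → Set 𝒰) : Prop where
  nonempty : ∀ x, (Φ x).Nonempty
  isCompact : ∀ x, IsCompact (Φ x)
  measurable : ∀ O : Set 𝒰, IsOpen O → MeasurableSet {x | (Φ x ∩ O).Nonempty}

namespace MeasurableCompactMulti

variable {Φ : X → Set 𝒰}

omit [TopologicalSpace.MetrizableSpace X] [TopologicalSpace.MetrizableSpace 𝒰] in
theorem measurableSet_open (hΦ : MeasurableCompactMulti Φ) {W : Set (X × 𝒰)} (hW : IsOpen W) :
    MeasurableSet {x | ∃ u ∈ Φ x, (x, u) ∈ W} := by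
  have hb := (TopologicalSpace.isBasis_countableBasis X).prod
    (TopologicalSpace.isBasis_countableBasis 𝒰)
  set S := {p : Set X × Set 𝒰 | p.1 ∈ TopologicalSpace.countableBasis X ∧
    p.2 ∈ TopologicalSpace.countableBasis 𝒰 ∧ p.1 ×ˢ p.2 ⊆ W} with hS
  have hSc : S.Countable :=
    ((TopologicalSpace.countable_countableBasis X).prod
      (TopologicalSpace.countable_countableBasis 𝒰)).mono fun p hp => mk_mem_prod hp.1 hp.2.1
  have : {x | ∃ u ∈ Φ x, (x, u) ∈ W} = ⋃ p ∈ S, p.1 ∩ {x | (Φ x ∩ p.2).Nonempty} := by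
    ext x
    simp only [mem_ofPred_eq, mem_iUnion, exists_prop, mem_inter_iff]
    constructor
    · rintro ⟨u, hu, hxu⟩
      obtain ⟨s, hs, hmem, hsub⟩ := hb.exists_subset_of_mem_open
        (show (x, u) ∈ W from hxu) hW
      obtain ⟨A, hA, B, hB, rfl⟩ := hs
      exact ⟨(A, B), ⟨hA, hB, hsub⟩, hmem.1, u, hu, hmem.2⟩
    · rintro ⟨p, ⟨_, _, hsub⟩, hx, u, hu, hup⟩
      exact ⟨u, hu, hsub ⟨hx, hup⟩⟩
  rw [this]
  refine MeasurableSet.biUnion hSc fun p hp => MeasurableSet.inter ?_ (hΦ.measurable _ ?_)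
  · exact (TopologicalSpace.isOpen_of_mem_countableBasis hp.1).measurableSet
  · exact TopologicalSpace.isOpen_of_mem_countableBasis hp.2.1

/-- A closed set is the intersection of its thickenings, and compactness of `Φ x` allows the
intersection to be exchanged with the projection. -/
theorem measurableSet_closed (hΦ : MeasurableCompactMulti Φ) {C : Set (X × 𝒰)} (hC : IsClosed C) :
    MeasurableSet {x | ∃ u ∈ Φ x, (x, u) ∈ C} := by
  let _ := TopologicalSpace.metrizableSpaceMetric X
  let _ := TopologicalSpace.metrizableSpaceMetric 𝒰
  have : {x | ∃ u ∈ Φ x, (x, u) ∈ C} =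
      ⋂ n : ℕ, {x | ∃ u ∈ Φ x, (x, u) ∈ Metric.thickening (1 / (n + 1 : ℝ)) C} := by
    ext x
    simp only [mem_ofPred_eq, mem_iInter]
    constructor
    · rintro ⟨u, hu, hxu⟩ n
      exact ⟨u, hu, Metric.self_subset_thickening (by positivity) _ hxu⟩
    · intro h
      by_contra! hcon
      have hK : IsCompact (({x} : Set X) ×ˢ Φ x) := isCompact_singleton.prod (hΦ.isCompact x)
      obtain ⟨δ, hδ, hsub⟩ := hK.exists_thickening_subset_open hC.isOpen_compl (by
        rintro ⟨y, u⟩ ⟨hy, hu⟩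
        obtain rfl : y = x := hy
        exact hcon u hu)
      obtain ⟨n, hn⟩ := exists_nat_one_div_lt hδ
      obtain ⟨u, hu, hxu⟩ := h n
      obtain ⟨z, hz, hd⟩ := Metric.mem_thickening_iff.1 hxu
      refine hsub (Metric.mem_thickening_iff.2 ⟨(x, u), ⟨rfl, hu⟩, ?_⟩) hz
      rw [dist_comm]
      exact hd.trans hn
  rw [this]
  exact MeasurableSet.iInter fun n => hΦ.measurableSet_open Metric.isOpen_thickening

theorem measurableSet_le (hΦ : MeasurableCompactMulti Φ) {f : X × 𝒰 → ℝ}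
    (hf : LowerSemicontinuousOn f {z | z.2 ∈ Φ z.1}) {F : Set 𝒰} (hF : IsClosed F) (a : ℝ) :
    MeasurableSet {x | ∃ u ∈ Φ x, u ∈ F ∧ f (x, u) ≤ a} := by
  obtain ⟨W, hW, hWeq⟩ := (lowerSemicontinuousOn_iff_preimage_Ioi.1 hf) a
  have : {x | ∃ u ∈ Φ x, u ∈ F ∧ f (x, u) ≤ a} =
      {x | ∃ u ∈ Φ x, (x, u) ∈ Wᶜ ∩ Prod.snd ⁻¹' F} := by
    ext x
    refine exists_congr fun u => and_congr_right fun hu => ?_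
    have := Set.ext_iff.1 hWeq (x, u)
    simp only [mem_inter_iff, mem_ofPred_eq, hu, true_and, mem_preimage, mem_Ioi] at this
    simp only [mem_inter_iff, mem_compl_iff, mem_preimage, ← this, not_lt]
    tauto
  rw [this]
  exact hΦ.measurableSet_closed (hW.isClosed_compl.inter (hF.preimage continuous_snd))

/-- The minimum of a lower semicontinuous function over the values of `Φ` is a measurable
function, and the minimizers form a measurable multifunction again. -/
theorem exists_min (hΦ : MeasurableCompactMulti Φ) {f : X × 𝒰 → ℝ}
    (hf : LowerSemicontinuousOn f {z | z.2 ∈ Φ z.1}) :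
    ∃ g : X → ℝ, Measurable g ∧ (∀ x, ∀ u ∈ Φ x, g x ≤ f (x, u)) ∧
      MeasurableCompactMulti (fun x => {u | u ∈ Φ x ∧ f (x, u) = g x}) := by
  choose m hm hmin using fun x =>
    (hf.comp_prodMk x).exists_isMinOn (hΦ.nonempty x) (hΦ.isCompact x)
  have hle : ∀ x, ∀ u ∈ Φ x, f (x, m x) ≤ f (x, u) := fun x u hu => hmin x hu
  have hmeas : Measurable fun x => f (x, m x) := by
    refine measurable_of_Iic fun a => ?_
    convert hΦ.measurableSet_le hf isClosed_univ a using 1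
    ext x
    exact ⟨fun h => ⟨m x, hm x, mem_univ _, h⟩, fun ⟨u, hu, _, h⟩ => (hle x u hu).trans h⟩
  refine ⟨fun x => f (x, m x), hmeas, hle, fun x => ⟨m x, hm x, rfl⟩, fun x => ?_, fun O hO => ?_⟩
  · obtain ⟨W, hW, hWeq⟩ :=
      lowerSemicontinuousOn_iff_preimage_Ioi.1 (hf.comp_prodMk x) (f (x, m x))
    convert (hΦ.isCompact x).inter_right hW.isClosed_compl using 1
    ext u
    refine and_congr_right fun hu => ?_
    have := Set.ext_iff.1 hWeq u
    simp only [mem_inter_iff, hu, true_and, mem_preimage, mem_Ioi] at this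
    rw [mem_compl_iff, ← this, not_lt]
    exact ⟨fun h => h.le, fun h => h.antisymm (hle x u hu)⟩
  · let _ := TopologicalSpace.metrizableSpaceMetric 𝒰
    -- Whether a minimizer lies in `O` is decided on the closed sets exhausting `O`, where the
    -- minimum over `Φ x` is attained as soon as it is approached.
    obtain ⟨F, hF, _, hFO, _⟩ := hO.exists_iUnion_isClosed
    have : {x | ({u | u ∈ Φ x ∧ f (x, u) = f (x, m x)} ∩ O).Nonempty} =
        ⋃ n, ⋂ q : ℚ, {x | f (x, m x) < q}ᶜ ∪ {x | ∃ u ∈ Φ x, u ∈ F n ∧ f (x, u) ≤ q} := by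
      ext x
      simp only [mem_ofPred_eq, mem_iUnion, mem_iInter, mem_union, mem_compl_iff]
      constructor
      · rintro ⟨u, ⟨hu, hfu⟩, huO⟩
        rw [← hFO] at huO
        obtain ⟨n, hn⟩ := mem_iUnion.1 huO
        exact ⟨n, fun q => (em _).symm.imp_right fun h => ⟨u, hu, hn, hfu ▸ h.le⟩⟩
      · rintro ⟨n, hn⟩
        have hq : ∀ q : ℚ, f (x, m x) < q → ∃ u ∈ Φ x, u ∈ F n ∧ f (x, u) ≤ q :=
          fun q h => (hn q).resolve_left (not_not.2 h)
        obtain ⟨q₀, hq₀⟩ := exists_rat_gt (f (x, m x))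
        obtain ⟨u₀, hu₀, hu₀F, _⟩ := hq q₀ hq₀
        obtain ⟨v, hv, hvmin⟩ :=
          ((hf.comp_prodMk x).mono inter_subset_left).exists_isMinOn
            (s := Φ x ∩ F n) ⟨u₀, hu₀, hu₀F⟩ ((hΦ.isCompact x).inter_right (hF n))
        refine ⟨v, ⟨hv.1, le_antisymm (le_of_forall_gt_imp_ge_of_dense fun r hr => ?_)
          (hle x v hv.1)⟩, hFO ▸ mem_iUnion.2 ⟨n, hv.2⟩⟩
        obtain ⟨q, hq1, hq2⟩ := exists_rat_btwn hr
        obtain ⟨u, hu, huF, hfu⟩ := hq q hq1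
        exact (hvmin ⟨hu, huF⟩ : f (x, v) ≤ f (x, u)).trans (hfu.trans hq2.le)
    rw [this]
    exact MeasurableSet.iUnion fun n => MeasurableSet.iInter fun q =>
      (measurableSet_lt hmeas measurable_const).compl.union (hΦ.measurableSet_le hf (hF n) q)

/-- Measurable selection. Minimizing the distances to the points of a dense sequence one after
the other leaves a point whose distance to every point of the sequence depends measurably on
`x`. -/
theorem exists_measurable_selector [MeasurableSpace 𝒰] [BorelSpace 𝒰]
    (hΦ : MeasurableCompactMulti Φ) :
    ∃ π : X → 𝒰, Measurable π ∧ ∀ x, π x ∈ Φ x := by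
  let _ := TopologicalSpace.metrizableSpaceMetric 𝒰
  rcases isEmpty_or_nonempty X with hX | ⟨⟨x₀⟩⟩
  · exact ⟨isEmptyElim, measurable_of_empty _, isEmptyElim⟩
  have : Nonempty 𝒰 := (hΦ.nonempty x₀).to_type
  set d : ℕ → 𝒰 := TopologicalSpace.denseSeq 𝒰
  have hstep : ∀ (i : ℕ) (Ψ : {Ψ : X → Set 𝒰 // MeasurableCompactMulti Ψ}),
      ∃ g : X → ℝ, Measurable g ∧
        MeasurableCompactMulti (fun x => {u | u ∈ Ψ.1 x ∧ dist u (d i) = g x}) := fun i Ψ => by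
    obtain ⟨g, hg, _, hm⟩ := Ψ.2.exists_min (f := fun z => dist z.2 (d i))
      ((by fun_prop : Continuous fun z : X × 𝒰 => dist z.2 (d i)).lowerSemicontinuous
        |>.lowerSemicontinuousOn _)
    exact ⟨g, hg, hm⟩
  choose g hg hm using hstep
  let Ψ : ℕ → {Ψ : X → Set 𝒰 // MeasurableCompactMulti Ψ} := fun n =>
    Nat.rec ⟨Φ, hΦ⟩ (fun i Ψ => ⟨_, hm i Ψ⟩) n
  have hsucc : ∀ i x, (Ψ (i + 1)).1 x = {u | u ∈ (Ψ i).1 x ∧ dist u (d i) = g i (Ψ i) x} :=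
    fun i x => rfl
  have hne : ∀ x, (⋂ i, (Ψ i).1 x).Nonempty := fun x =>
    IsCompact.nonempty_iInter_of_sequence_nonempty_isCompact_isClosed _
      (fun i => by rw [hsucc]; exact fun u hu => hu.1) (fun i => (Ψ i).2.nonempty x)
      ((Ψ 0).2.isCompact x) (fun i => ((Ψ i).2.isCompact x).isClosed)
  choose π hπ using hne
  have hmem : ∀ i x, π x ∈ (Ψ i).1 x := fun i x => mem_iInter.1 (hπ x) i
  have hdist : ∀ i, Measurable fun x => dist (π x) (d i) := fun i => by
    have : (fun x => dist (π x) (d i)) = g i (Ψ i) := funext fun x => by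
      have := hmem (i + 1) x
      rw [hsucc] at this
      exact this.2
    rw [this]
    exact hg _ _
  exact ⟨π, measurable_of_measurable_dist (TopologicalSpace.denseRange_denseSeq 𝒰) hdist,
    fun x => hmem 0 x⟩

end MeasurableCompactMulti

end Selection

/-! ### Measurable choice of dominated linear functionals -/

section Sublinear

variable {E : Type*} [AddCommGroup E] [Module ℝ E]

/-- Sublinear functionals: subadditive and positively homogeneous. -/
structure IsSublinear (ρ : E → ℝ) : Prop where
  add_le : ∀ φ ψ, ρ (φ + ψ) ≤ ρ φ + ρ ψ
  smul : ∀ (b : ℝ) φ, 0 < b → ρ (b • φ) = b * ρ φ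

namespace IsSublinear

variable {ρ : E → ℝ}

theorem map_zero (h : IsSublinear ρ) : ρ 0 = 0 := by
  have := h.smul 2 0 two_pos
  rw [smul_zero] at this
  linarith

theorem neg_le (h : IsSublinear ρ) (φ : E) : -ρ (-φ) ≤ ρ φ := by
  have := h.add_le φ (-φ)
  rw [add_neg_cancel, h.map_zero] at this
  linarith

theorem smul_nonneg (h : IsSublinear ρ) {b : ℝ} (hb : 0 ≤ b) (φ : E) : ρ (b • φ) = b * ρ φ := by
  rcases hb.eq_or_lt with rfl | hb
  · simp [h.map_zero]
  · exact h.smul b φ hb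

/-- The directional derivative of a sublinear functional `ρ` at `a`: the difference quotients
`(ρ (a + φ / n) - ρ a) * n = ρ (n a + φ) - n ρ a` decrease to it. -/
noncomputable def dirDeriv (ρ : E → ℝ) (a φ : E) : ℝ := ⨅ n : ℕ, ρ ((n : ℝ) • a + φ) - n * ρ a

theorem bddBelow_dirDeriv (h : IsSublinear ρ) (a φ : E) :
    BddBelow (range fun n : ℕ => ρ ((n : ℝ) • a + φ) - n * ρ a) := by
  refine ⟨-ρ (-φ), ?_⟩
  rintro _ ⟨n, rfl⟩
  have := h.add_le ((n : ℝ) • a + φ) (-φ)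
  rw [add_neg_cancel_right, h.smul_nonneg n.cast_nonneg] at this
  simp only
  linarith

theorem dirDeriv_le (h : IsSublinear ρ) (a φ : E) (n : ℕ) :
    dirDeriv ρ a φ ≤ ρ ((n : ℝ) • a + φ) - n * ρ a :=
  ciInf_le (h.bddBelow_dirDeriv a φ) n

theorem dirDeriv_le_self (h : IsSublinear ρ) (a φ : E) : dirDeriv ρ a φ ≤ ρ φ := by
  simpa using h.dirDeriv_le a φ 0

theorem dirDeriv_neg_le (h : IsSublinear ρ) (a : E) : dirDeriv ρ a (-a) ≤ -ρ a := by
  simpa [h.map_zero] using h.dirDeriv_le a (-a) 1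

theorem isSublinear_dirDeriv (h : IsSublinear ρ) (a : E) : IsSublinear (dirDeriv ρ a) := by
  have hsmul : ∀ (b : ℝ) φ, 0 < b →
      b * IsSublinear.dirDeriv ρ a φ ≤ IsSublinear.dirDeriv ρ a (b • φ) := by
    intro b φ hb
    refine le_ciInf fun n => ?_
    obtain ⟨m, hm⟩ := exists_nat_ge (n / b : ℝ)
    have hmn : 0 ≤ m * b - n := by
      have := (div_le_iff₀ hb).1 hm
      linarith
    have h1 := h.add_le ((n : ℝ) • a + b • φ) ((m * b - n) • a)
    have h2 : (n : ℝ) • a + b • φ + (m * b - n) • a = b • ((m : ℝ) • a + φ) := by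
      module
    rw [h2, h.smul _ _ hb, h.smul_nonneg hmn] at h1
    have h3 := mul_le_mul_of_nonneg_left (h.dirDeriv_le a φ m) hb.le
    linarith
  refine ⟨fun φ ψ => ?_, fun b φ hb => le_antisymm ?_ (hsmul b φ hb)⟩
  · refine le_ciInf_add_ciInf fun n m => (h.dirDeriv_le a (φ + ψ) (n + m)).trans ?_
    have h1 := h.add_le ((n : ℝ) • a + φ) ((m : ℝ) • a + ψ)
    have h2 : (n : ℝ) • a + φ + ((m : ℝ) • a + ψ) = ((n + m : ℕ) : ℝ) • a + (φ + ψ) := by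
      push_cast
      module
    rw [h2] at h1
    push_cast at h1 ⊢
    linarith
  · have := mul_le_mul_of_nonneg_left (hsmul b⁻¹ (b • φ) (inv_pos.2 hb)) hb.le
    rwa [inv_smul_smul₀ hb.ne', mul_inv_cancel_left₀ hb.ne'] at this

end IsSublinear

/-- A Hahn–Banach theorem with measurable dependence on a parameter. Passing from `ρ` to its
directional derivative at `a` makes the functional linear along `a` and keeps it dominated by `ρ`;
doing so along `φ₀` and then along a dense sequence leaves a linear functional. Every step is a
countable infimum, so it preserves measurability. -/
theorem exists_measurable_linear_le {T E : Type*} [MeasurableSpace T] [NormedAddCommGroup E]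
    [NormedSpace ℝ E] [TopologicalSpace.SeparableSpace E] (ρ : T → E → ℝ)
    (hρ : ∀ t, IsSublinear (ρ t)) (hcont : ∀ t, Continuous (ρ t))
    (hmeas : ∀ φ, Measurable fun t => ρ t φ) (φ₀ : E) :
    ∃ ℓ : T → E →ₗ[ℝ] ℝ, (∀ t, Continuous (ℓ t)) ∧ (∀ t φ, ℓ t φ ≤ ρ t φ) ∧
      (∀ t, ℓ t φ₀ = ρ t φ₀) ∧ ∀ φ, Measurable fun t => ℓ t φ := by
  let d : ℕ → E := fun n => Nat.casesOn n φ₀ (TopologicalSpace.denseSeq E)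
  have hd : DenseRange d := (TopologicalSpace.denseRange_denseSeq E).mono (by
    rintro _ ⟨n, rfl⟩
    exact ⟨n + 1, rfl⟩)
  let r : ℕ → T → E → ℝ := fun n => Nat.rec ρ (fun n r t => IsSublinear.dirDeriv (r t) (d n)) n
  have hr : ∀ (n : ℕ) (t : T), IsSublinear (r n t) := fun n => by
    induction n with
    | zero => exact hρ
    | succ n ih => exact fun t => (ih t).isSublinear_dirDeriv (d n)
  have hanti : ∀ t φ, Antitone fun n => r n t φ := fun t φ =>
    antitone_nat_of_succ_le fun n => (hr n t).dirDeriv_le_self (d n) φ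
  have hrm : ∀ (n : ℕ) (φ : E), Measurable (fun t : T => r n t φ) := by
    intro n
    induction n with
    | zero => exact hmeas
    | succ n ih =>
      exact fun φ => Measurable.iInf fun k => (ih _).sub ((ih _).const_mul _)
  have hbdd : ∀ t φ, BddBelow (range fun n => r n t φ) := fun t φ => ⟨-ρ t (-φ), by
    rintro _ ⟨n, rfl⟩
    exact (neg_le_neg (hanti t (-φ) (Nat.zero_le n))).trans ((hr n t).neg_le φ)⟩
  let ℓ : T → E → ℝ := fun t φ => ⨅ n, r n t φ
  have hle : ∀ t φ n, ℓ t φ ≤ r n t φ := fun t φ n => ciInf_le (hbdd t φ) n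
  have hsub : ∀ t, IsSublinear (ℓ t) := fun t => by
    refine ⟨fun φ ψ => le_ciInf_add_ciInf fun i j => (hle t _ (max i j)).trans
      (((hr _ t).add_le φ ψ).trans
        (add_le_add (hanti t φ (le_max_left i j)) (hanti t ψ (le_max_right i j)))), ?_⟩
    intro b φ hb
    simp only [ℓ, (hr _ t).smul b φ hb]
    exact (Real.mul_iInf_of_nonneg hb.le _).symm
  have hcl : ∀ t, Continuous (ℓ t) := fun t => by
    have hlip : ∀ φ ψ, |ℓ t φ - ℓ t ψ| ≤ max (ρ t (φ - ψ)) (ρ t (ψ - φ)) := fun φ ψ => by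
      have h1 := (hsub t).add_le (φ - ψ) ψ
      have h2 := (hsub t).add_le (ψ - φ) φ
      rw [sub_add_cancel] at h1 h2
      have h3 : ℓ t (φ - ψ) ≤ ρ t (φ - ψ) := hle t (φ - ψ) 0
      have h4 : ℓ t (ψ - φ) ≤ ρ t (ψ - φ) := hle t (ψ - φ) 0
      exact abs_sub_le_iff.2 ⟨le_max_of_le_left (by linarith), le_max_of_le_right (by linarith)⟩
    refine continuous_iff_continuousAt.2 fun ψ => tendsto_iff_norm_sub_tendsto_zero.2 ?_
    refine squeeze_zero (fun _ => norm_nonneg _) (fun φ => hlip φ ψ) ?_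
    have : Continuous fun φ => max (ρ t (φ - ψ)) (ρ t (ψ - φ)) :=
      ((hcont t).comp (continuous_id.sub continuous_const)).max
        ((hcont t).comp (continuous_const.sub continuous_id))
    simpa [(hρ t).map_zero] using this.tendsto ψ
  have hstep : ∀ t n, ℓ t (-d n) ≤ -r n t (d n) := fun t n =>
    (hle t _ (n + 1)).trans ((hr n t).dirDeriv_neg_le (d n))
  -- A sublinear functional is linear once it is odd, and by continuity oddness along `d` suffices.
  have hodd : ∀ t φ, ℓ t (-φ) = -ℓ t φ := fun t => by
    refine congr_fun (hd.equalizer ((hcl t).comp continuous_neg) (hcl t).neg (funext fun n => ?_))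
    refine le_antisymm ?_ ?_
    · exact (hstep t n).trans (neg_le_neg (hle t _ n))
    · have := (hsub t).neg_le (d n)
      simp only [Function.comp_apply]
      linarith
  refine ⟨fun t => ⟨⟨ℓ t, fun φ ψ => le_antisymm ((hsub t).add_le φ ψ) ?_⟩, fun b φ => ?_⟩,
    hcl, fun t φ => hle t φ 0, fun t => le_antisymm (hle t φ₀ 0) ?_,
    fun φ => Measurable.iInf (hrm · φ)⟩
  · have := (hsub t).add_le (-φ) (-ψ)
    rw [← neg_add, hodd, hodd, hodd] at this
    linarith
  · simp only [RingHom.id_apply, smul_eq_mul]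
    rcases le_or_gt 0 b with hb | hb
    · exact (hsub t).smul_nonneg hb φ
    · have := (hsub t).smul (-b) φ (neg_pos.2 hb)
      rw [neg_smul, hodd] at this
      linarith
  · have := hstep t 0
    rw [hodd] at this
    exact neg_le_neg_iff.1 this

end Sublinear

open RiskMDP

/-! ### Positive functionals on `L_p` as measures with density in `L_q` -/

section Duality

variable {X : Type*} [MeasurableSpace X] {p : ℝ≥0∞} {P₀ : Measure X}

/-- The converse of Hölder's inequality. For `1 < p` it results from testing with the powers
`(f ∧ n) ^ (q - 1)` of the truncations of the density `f`. -/
theorem memLp_rnDeriv_of_lintegral_le [IsFiniteMeasure P₀] (hp1 : 1 ≤ p) (hp : p ≠ ∞)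
    {ν : Measure X} [IsFiniteMeasure ν] (hν : ν ≪ P₀) {L : ℝ≥0∞} (hL : L ≠ ∞)
    (h : ∀ s : SimpleFunc X ℝ≥0, ∫⁻ x, s x ∂ν ≤ L * eLpNorm (fun x => (s x : ℝ)) p P₀) :
    MemLp (fun x => (ν.rnDeriv P₀ x).toReal) (ENNReal.conjExponent p) P₀ := by
  have hp0 : p ≠ 0 := (zero_lt_one.trans_le hp1).ne'
  have hpr : 0 < p.toReal := ENNReal.toReal_pos hp0 hp
  set f := ν.rnDeriv P₀
  have hf : Measurable f := Measure.measurable_rnDeriv ν P₀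
  have hfin : ∀ᵐ x ∂P₀, f x < ∞ := Measure.rnDeriv_lt_top ν P₀
  have hmul : ∀ g : X → ℝ≥0∞, Measurable g → ∫⁻ x, f x * g x ∂P₀ = ∫⁻ x, g x ∂ν := fun g hg => by
    rw [← Measure.withDensity_rnDeriv_eq ν P₀ hν, lintegral_withDensity_eq_lintegral_mul _ hf hg]
    rfl
  have key : ∀ g : X → ℝ≥0∞, Measurable g →
      ∫⁻ x, f x * g x ∂P₀ ≤ L * (∫⁻ x, g x ^ p.toReal ∂P₀) ^ (1 / p.toReal) := fun g hg => by
    rw [hmul g hg, lintegral_eq_nnreal]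
    refine iSup₂_le fun s hs => ?_
    rw [← SimpleFunc.lintegral_eq_lintegral]
    refine (h s).trans (mul_le_mul_right ?_ L)
    rw [eLpNorm_eq_lintegral_rpow_enorm_toReal hp0 hp]
    refine ENNReal.rpow_le_rpow (lintegral_mono fun x => ENNReal.rpow_le_rpow ?_ hpr.le)
      (by positivity)
    simpa using hs x
  refine ⟨hf.ennreal_toReal.aestronglyMeasurable, ?_⟩
  have henorm : ∀ᵐ x ∂P₀, ‖(f x).toReal‖ₑ = f x := hfin.mono fun x hx => by
    rw [Real.enorm_eq_ofReal ENNReal.toReal_nonneg, ENNReal.ofReal_toReal hx.ne]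
  rcases hp1.eq_or_lt with rfl | hp1
  · rw [ENNReal.conjExponent, tsub_self, ENNReal.inv_zero, add_top, eLpNorm_exponent_top]
    refine (essSup_le_of_ae_le L ?_).trans_lt hL.lt_top
    have : f ≤ᵐ[P₀] fun _ => L := by
      refine ae_le_of_forall_setLIntegral_le_of_sigmaFinite hf fun s hs _ => ?_
      have := key (s.indicator 1) (measurable_one.indicator hs)
      simp only [ENNReal.toReal_one, ENNReal.rpow_one, div_one, lintegral_indicator_one hs] at this
      rw [setLIntegral_const, ← lintegral_indicator hs]
      refine le_trans (lintegral_mono fun x => ?_) this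
      by_cases hx : x ∈ s <;> simp [hx]
    filter_upwards [this, henorm] with x h1 h2
    exact h2.trans_le h1
  have hp1r : 1 < p.toReal := by
    rwa [← ENNReal.toReal_one, ENNReal.toReal_lt_toReal ENNReal.one_ne_top hp]
  have hq : ENNReal.conjExponent p = ENNReal.ofReal (Real.conjExponent p.toReal) := by
    lift p to ℝ≥0 using hp
    have hp1' : 1 < p := by exact_mod_cast hp1
    rw [← ENNReal.coe_conjExponent hp1', ← ENNReal.ofReal_coe_nnreal, NNReal.conjExponent,
      NNReal.coe_div, NNReal.coe_sub hp1'.le]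
    rfl
  have hpq := Real.HolderConjugate.conjExponent hp1r
  set q := Real.conjExponent p.toReal
  rw [hq, eLpNorm_eq_lintegral_rpow_enorm_toReal (by simpa using hpq.symm.pos)
    ENNReal.ofReal_ne_top, ENNReal.toReal_ofReal hpq.symm.nonneg]
  refine ENNReal.rpow_lt_top_of_nonneg (one_div_nonneg.2 hpq.symm.nonneg) (ne_of_lt ?_)
  rw [lintegral_congr_ae (g := fun x => f x ^ q) (henorm.mono fun x hx => by simp only [hx])]
  refine lt_of_le_of_lt ?_ (ENNReal.rpow_lt_top_of_nonneg hpq.symm.nonneg hL)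
  -- The integral `I` of the truncated power is finite and satisfies `I ≤ L * I ^ (1 / p)`.
  have htr : ∀ n : ℕ, ∫⁻ x, min (f x) n ^ q ∂P₀ ≤ L ^ q := fun n => by
    set I := ∫⁻ x, min (f x) n ^ q ∂P₀ with hI
    have hIfin : I ≠ ∞ := by
      refine ne_of_lt (lt_of_le_of_lt (lintegral_mono fun x => ENNReal.rpow_le_rpow
        (min_le_right _ _) hpq.symm.nonneg) ?_)
      rw [lintegral_const]
      exact ENNReal.mul_lt_top (ENNReal.rpow_lt_top_of_nonneg hpq.symm.nonneg
        (ENNReal.natCast_ne_top n)) (measure_lt_top _ _)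
    have h1 : I ≤ L * I ^ (1 / p.toReal) := by
      have := key (fun x => min (f x) n ^ (q - 1)) ((hf.min measurable_const).pow_const _)
      simp only [← ENNReal.rpow_mul, hpq.symm.sub_one_mul_conj] at this
      refine le_trans (lintegral_mono fun x => ?_) this
      have : min (f x) (n : ℝ≥0∞) ^ q = min (f x) n * min (f x) n ^ (q - 1) := by
        conv_lhs => rw [show q = 1 + (q - 1) by ring]
        rw [ENNReal.rpow_add_of_nonneg _ _ zero_le_one (sub_nonneg.2 hpq.symm.lt.le),
          ENNReal.rpow_one]
      simp only [this]
      exact mul_le_mul_left (min_le_left _ _) _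
    rcases eq_or_ne I 0 with h0 | h0
    · simp [h0]
    have h2 : I ^ (1 / q) ≤ L := by
      have hs : 1 / q + 1 / p.toReal = 1 := by
        have := hpq.inv_add_inv_eq_one
        rw [one_div, one_div, add_comm, this]
      have hpow : I ^ (1 / q) * I ^ (1 / p.toReal) = I := by
        rw [← ENNReal.rpow_add _ _ h0 hIfin, hs, ENNReal.rpow_one]
      have h3 : I ^ (1 / p.toReal) ≠ 0 := by simp [h0, hIfin]
      have h4 : I ^ (1 / p.toReal) ≠ ∞ := ENNReal.rpow_ne_top_of_nonneg (by positivity) hIfin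
      rw [← ENNReal.mul_le_mul_iff_left h3 h4, hpow]
      exact h1
    calc I = (I ^ (1 / q)) ^ q := by
          rw [← ENNReal.rpow_mul, one_div_mul_cancel hpq.symm.ne_zero, ENNReal.rpow_one]
      _ ≤ L ^ q := ENNReal.rpow_le_rpow h2 hpq.symm.nonneg
  have hmono : Monotone fun n : ℕ => fun x => min (f x) (n : ℝ≥0∞) ^ q := fun m n hmn x =>
    ENNReal.rpow_le_rpow (min_le_min_left _ (by exact_mod_cast hmn)) hpq.symm.nonneg
  have hsup : ∀ x, f x ^ q = ⨆ n : ℕ, min (f x) (n : ℝ≥0∞) ^ q := fun x => by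
    have h1 : Tendsto (fun n : ℕ => min (f x) (n : ℝ≥0∞)) atTop (𝓝 (min (f x) ∞)) :=
      tendsto_const_nhds.min ENNReal.tendsto_nat_nhds_top
    rw [min_top_right] at h1
    exact tendsto_nhds_unique ((ENNReal.continuous_rpow_const.tendsto _).comp h1)
      (tendsto_atTop_iSup fun m n hmn => hmono hmn x)
  simp only [hsup]
  rw [lintegral_iSup (fun n => (hf.min measurable_const).pow_const _) hmono]
  exact iSup_le htr

variable [Fact (1 ≤ p)]

theorem RiskMDP.InDual.integrable [IsFiniteMeasure P₀] {m : Measure X} (hm : InDual p P₀ m)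
    {φ : X → ℝ} (hφ : MemLp φ p P₀) : Integrable φ m := by
  have := hm.1
  exact (integrable_toReal_rnDeriv_mul_iff hm.2.1).1 (hm.2.2.integrable_mul hφ)

theorem RiskMDP.InDual.continuous_integral [IsFiniteMeasure P₀] {m : Measure X}
    (hm : InDual p P₀ m) : Continuous fun φ : Lp ℝ p P₀ => ∫ y, φ y ∂m := by
  have := hm.1
  have : Fact (1 ≤ ENNReal.conjExponent p) := ⟨by simp [ENNReal.conjExponent]⟩
  have heq : (fun φ : Lp ℝ p P₀ => ∫ y, φ y ∂m) = fun φ =>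
      (ContinuousLinearMap.mul ℝ ℝ).lpPairing P₀ (ENNReal.conjExponent p) p hm.2.2.toLp φ := by
    funext φ
    rw [ContinuousLinearMap.lpPairing_eq_integral, ← integral_toReal_rnDeriv_mul hm.2.1]
    refine integral_congr_ae (hm.2.2.coeFn_toLp.mono fun y hy => ?_)
    simp [hy]
  rw [heq]
  exact ContinuousLinearMap.continuous _

/-- Monotone normalized continuous functionals on `L_p` are integrals with respect to elements of
`𝓜`. -/
theorem exists_dualProb_of_linear [IsProbabilityMeasure P₀] (hp : p ≠ ∞) (ℓ : Lp ℝ p P₀ →ₗ[ℝ] ℝ)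
    (hcont : Continuous ℓ) (hpos : ∀ φ : Lp ℝ p P₀, 0 ≤ φ → 0 ≤ ℓ φ)
    (hone : ℓ (Lp.const p P₀ 1) = 1) : ∃ μ : DualProb p P₀, ∀ φ : Lp ℝ p P₀,
      ∫ y, φ y ∂μ.1 = ℓ φ := by
  have hp1 : 1 ≤ p := Fact.out
  have hp0 : p ≠ 0 := (zero_lt_one.trans_le hp1).ne'
  let χ : ∀ B : Set X, MeasurableSet B → Lp ℝ p P₀ := fun B hB =>
    indicatorConstLp p hB (measure_ne_top P₀ B) 1
  have hχ0 : ∀ B hB, 0 ≤ χ B hB := fun B hB => by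
    rw [← Lp.coeFn_nonneg]
    filter_upwards [indicatorConstLp_coeFn (p := p) (hs := hB) (hμs := measure_ne_top P₀ B)
      (c := (1 : ℝ))] with y hy
    rw [hy]
    exact indicator_nonneg (fun _ _ => zero_le_one) y
  have hℓ0 : ∀ B hB, 0 ≤ ℓ (χ B hB) := fun B hB => hpos _ (hχ0 B hB)
  have hunion : ∀ A B hA hB, Disjoint A B →
      ℓ (χ (A ∪ B) (hA.union hB)) = ℓ (χ A hA) + ℓ (χ B hB) := fun A B hA hB hd => by
    rw [← map_add]
    exact congr_arg ℓ (indicatorConstLp_disjoint_union hA hB _ _ hd 1)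
  have hempty : ℓ (χ ∅ MeasurableSet.empty) = 0 := by
    have := hunion ∅ ∅ MeasurableSet.empty MeasurableSet.empty (disjoint_empty _)
    simp only [empty_union] at this
    linarith
  -- Countable additivity is continuity of `ℓ` along the indicators of the partial unions; it is
  -- here that `p < ∞` matters.
  have hsigma : ∀ (B : ℕ → Set X) (hB : ∀ i, MeasurableSet (B i)),
      Pairwise (Function.onFun Disjoint B) →
      HasSum (fun i => ℓ (χ (B i) (hB i))) (ℓ (χ (⋃ i, B i) (MeasurableSet.iUnion hB))) := by
    intro B hB hd
    have hU : ∀ n, MeasurableSet (⋃ i ∈ Finset.range n, B i) := fun n =>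
      Finset.measurableSet_biUnion _ fun i _ => hB i
    have hsum : ∀ n, ∑ i ∈ Finset.range n, ℓ (χ (B i) (hB i)) = ℓ (χ _ (hU n)) := fun n => by
      induction n with
      | zero => simpa using hempty.symm
      | succ n ih =>
        have hdis : Disjoint (B n) (⋃ i ∈ Finset.range n, B i) := by
          simp only [disjoint_iUnion_right, Finset.mem_range]
          exact fun i hi => hd hi.ne'
        rw [Finset.sum_range_succ, ih, add_comm, ← hunion _ _ (hB n) (hU n) hdis]
        congr 2
        simp [Finset.range_add_one]
    rw [hasSum_iff_tendsto_nat_of_nonneg (fun i => hℓ0 _ _)]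
    simp only [hsum]
    refine (hcont.tendsto _).comp (tendsto_indicatorConstLp_set hp ?_)
    have hmono : Monotone fun n => ⋃ i ∈ Finset.range n, B i := fun m n hmn =>
      biUnion_subset_biUnion_left fun i hi => Finset.mem_range.2
        ((Finset.mem_range.1 hi).trans_le hmn)
    have hUe : ⋃ n, ⋃ i ∈ Finset.range n, B i = ⋃ i, B i := by
      ext x
      simp only [mem_iUnion, Finset.mem_range]
      exact ⟨fun ⟨_, i, _, hx⟩ => ⟨i, hx⟩, fun ⟨i, hx⟩ => ⟨i + 1, i, i.lt_succ_self, hx⟩⟩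
    have hsub : ∀ n, ⋃ i ∈ Finset.range n, B i ⊆ ⋃ i, B i := fun n =>
      iUnion₂_subset fun i _ => subset_iUnion B i
    have htend := tendsto_measure_iUnion_atTop (μ := P₀) hmono
    rw [hUe] at htend
    have := ENNReal.Tendsto.sub (tendsto_const_nhds (x := P₀ (⋃ i, B i))) htend
      (Or.inl (measure_ne_top _ _))
    rw [tsub_self] at this
    refine this.congr fun n => ?_
    rw [symmDiff_of_le (hsub n), measure_sdiff (hsub n) (hU n).nullMeasurableSet
      (measure_ne_top _ _)]
    rfl
  let ν : Measure X := Measure.ofMeasurable (fun B hB => ENNReal.ofReal (ℓ (χ B hB)))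
    (by simp [hempty]) (fun B hB hd => by
      rw [(hsigma B hB hd).tsum_eq.symm,
        ENNReal.ofReal_tsum_of_nonneg (fun i => hℓ0 _ _) (hsigma B hB hd).summable])
  have hνB : ∀ B hB, ν B = ENNReal.ofReal (ℓ (χ B hB)) := fun B hB =>
    Measure.ofMeasurable_apply B hB
  have hprob : IsProbabilityMeasure ν := ⟨by
    rw [hνB _ MeasurableSet.univ]
    have : χ univ MeasurableSet.univ = Lp.const p P₀ 1 := indicatorConstLp_univ _ _ _
    rw [this, hone, ENNReal.ofReal_one]⟩
  have hac : ν ≪ P₀ := Measure.AbsolutelyContinuous.mk fun B hB h0 => by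
    have : χ B hB = χ ∅ MeasurableSet.empty := by
      refine (indicatorConstLp_inj _ _ _ _ one_ne_zero).2 ?_
      exact ae_eq_empty.2 h0
    rw [hνB _ hB, this, hempty, ENNReal.ofReal_zero]
  have hsimple : ∀ s : SimpleFunc X ℝ, ∀ hs : MemLp s p P₀, ∫ y, s y ∂ν = ℓ hs.toLp := by
    have hmem : ∀ s : SimpleFunc X ℝ, MemLp s p P₀ := fun s => s.memLp_of_isFiniteMeasure p P₀
    have hint : ∀ s : SimpleFunc X ℝ, Integrable s ν := fun s => s.integrable_of_isFiniteMeasure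
    refine SimpleFunc.induction (fun c B hB hs => ?_) (fun f g _ hf hg hs => ?_)
    · have h1 : hs.toLp = c • χ B hB := by
        refine Lp.ext (hs.coeFn_toLp.trans (EventuallyEq.symm ?_))
        filter_upwards [Lp.coeFn_smul c (χ B hB), indicatorConstLp_coeFn (p := p) (hs := hB)
          (hμs := measure_ne_top P₀ B) (c := (1 : ℝ))] with y h1 h2
        rw [h1, Pi.smul_apply, h2]
        by_cases hy : y ∈ B <;> simp [hy]
      rw [h1, map_smul, smul_eq_mul]
      have h2 : (fun y => (SimpleFunc.piecewise B hB (SimpleFunc.const X c)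
          (SimpleFunc.const X 0)) y) = B.indicator fun _ => c := by
        funext y
        by_cases hy : y ∈ B <;> simp [hy]
      rw [h2, integral_indicator_const _ hB, measureReal_def, hνB _ hB,
        ENNReal.toReal_ofReal (hℓ0 _ _), smul_eq_mul, mul_comm]
    · have h1 : hs.toLp = (hmem f).toLp + (hmem g).toLp := rfl
      rw [h1, map_add, ← hf (hmem f), ← hg (hmem g)]
      simp only [SimpleFunc.coe_add, Pi.add_apply]
      exact integral_add (hint f) (hint g)
  let ℓc : Lp ℝ p P₀ →L[ℝ] ℝ := ⟨ℓ, hcont⟩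
  have hdual : InDual p P₀ ν := by
    refine ⟨hprob, hac, memLp_rnDeriv_of_lintegral_le hp1 hp hac
      (L := ENNReal.ofReal ‖ℓc‖) ENNReal.ofReal_ne_top fun s => ?_⟩
    have hs : MemLp (s.map ((↑) : ℝ≥0 → ℝ)) p P₀ := SimpleFunc.memLp_of_isFiniteMeasure _ p P₀
    have h1 : ∫⁻ x, s x ∂ν = ENNReal.ofReal (∫ x, (s.map ((↑) : ℝ≥0 → ℝ)) x ∂ν) := by
      rw [ofReal_integral_eq_lintegral_ofReal (SimpleFunc.integrable_of_isFiniteMeasure _)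
        (ae_of_all _ fun x => by simp)]
      simp
    rw [h1, hsimple _ hs]
    have h2 : ℓ hs.toLp ≤ ‖ℓc‖ * ‖hs.toLp‖ := (le_abs_self _).trans (ℓc.le_opNorm _)
    refine (ENNReal.ofReal_le_ofReal h2).trans ?_
    rw [ENNReal.ofReal_mul (norm_nonneg _), Lp.norm_toLp, ENNReal.ofReal_toReal hs.2.ne]
    rfl
  refine ⟨⟨ν, hdual⟩, fun φ => ?_⟩
  refine congr_fun (Continuous.ext_on (Lp.simpleFunc.dense hp)
    hdual.continuous_integral hcont fun ψ hψ => ?_) φ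
  obtain ⟨s, hs⟩ : ∃ s : Lp.simpleFunc ℝ p P₀, (s : Lp ℝ p P₀) = ψ := ⟨⟨ψ, hψ⟩, rfl⟩
  have h1 := Lp.simpleFunc.toSimpleFunc_eq_toFun s
  have h2 := Lp.simpleFunc.memLp s
  have h3 : ψ = h2.toLp := by
    refine Lp.ext ?_
    rw [← hs]
    exact h1.symm.trans h2.coeFn_toLp.symm
  have h4 := hsimple _ h2
  rw [h3, ← h4]
  exact integral_congr_ae (hac.ae_le h2.coeFn_toLp)

end Duality

/-! ### Convergence and measurability in `L_p` -/

section Lp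

variable {X : Type*} [MeasurableSpace X] {p : ℝ≥0∞} {P₀ : Measure X} [Fact (1 ≤ p)]

theorem tendsto_toLp_of_dominated (hp : p ≠ ∞) {f : ℕ → X → ℝ} {g F : X → ℝ}
    (hf : ∀ n, MemLp (f n) p P₀) (hg : MemLp g p P₀) (hF : MemLp F p P₀)
    (hb : ∀ n x, |f n x| ≤ F x) (hlim : ∀ x, Tendsto (fun n => f n x) atTop (𝓝 (g x))) :
    Tendsto (fun n => (hf n).toLp) atTop (𝓝 hg.toLp) := by
  have hp0 : p ≠ 0 := (zero_lt_one.trans_le (Fact.out : 1 ≤ p)).ne'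
  have hpr : 0 < p.toReal := ENNReal.toReal_pos hp0 hp
  rw [Lp.tendsto_Lp_iff_tendsto_eLpNorm'']
  simp only [eLpNorm_eq_lintegral_rpow_enorm_toReal hp0 hp]
  have h2F : MemLp (fun x => 2 * F x) p P₀ := hF.const_mul 2
  have hgF : ∀ x, |g x| ≤ F x := fun x =>
    le_of_tendsto (hlim x).abs (Eventually.of_forall fun n => hb n x)
  have hint : Tendsto (fun n => ∫⁻ x, ‖(f n - g) x‖ₑ ^ p.toReal ∂P₀) atTop
      (𝓝 (∫⁻ _, 0 ∂P₀)) := by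
    refine tendsto_lintegral_of_dominated_convergence' (fun x => ‖2 * F x‖ₑ ^ p.toReal)
      (fun n => (((hf n).sub hg).1.enorm).pow_const _) (fun n => ae_of_all _ fun x => ?_)
      ((eLpNorm_lt_top_iff_lintegral_rpow_enorm_lt_top hp0 hp).1 h2F.2).ne
      (ae_of_all _ fun x => ?_)
    · refine ENNReal.rpow_le_rpow (enorm_le_iff_norm_le.2 ?_) hpr.le
      have h0 : 0 ≤ F x := (abs_nonneg _).trans (hgF x)
      rw [Real.norm_eq_abs, Real.norm_eq_abs, abs_of_nonneg (by linarith : 0 ≤ 2 * F x)]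
      exact (abs_sub _ _).trans (by linarith [hb n x, hgF x])
    · have h1 : Tendsto (fun n => (f n - g) x) atTop (𝓝 0) := by
        simpa using (hlim x).sub_const (g x)
      have h2 := ((ENNReal.continuous_rpow_const (y := p.toReal)).tendsto _).comp
        ((continuous_enorm.tendsto _).comp h1)
      simpa [hpr, Function.comp_def] using h2
  rw [lintegral_zero] at hint
  have := ((ENNReal.continuous_rpow_const (y := 1 / p.toReal)).tendsto _).comp hint
  simpa [hpr, Function.comp_def] using this

/-- A Carathéodory function may be evaluated along a measurable family in `L_p`. -/
theorem measurable_comp_toLp [SFinite P₀] [MeasurableSpace.CountablyGenerated X] (hp : p ≠ ∞)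
    {H : Type*} [MeasurableSpace H] {F : H → Lp ℝ p P₀ → ℝ} (hFc : ∀ h, Continuous (F h))
    (hFm : ∀ φ, Measurable fun h => F h φ) {Z : H → X → ℝ}
    (hZ : Measurable fun q : H × X => Z q.1 q.2) (hZp : ∀ h, MemLp (Z h) p P₀) :
    Measurable fun h => F h (hZp h).toLp := by
  have hp0 : p ≠ 0 := (zero_lt_one.trans_le (Fact.out : 1 ≤ p)).ne'
  have : Fact (p ≠ ∞) := ⟨hp⟩
  let _ : MeasurableSpace (Lp ℝ p P₀) := borel _
  have : BorelSpace (Lp ℝ p P₀) := ⟨rfl⟩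
  have h1 : Measurable fun h => (hZp h).toLp := by
    refine measurable_of_measurable_dist
      (TopologicalSpace.denseRange_denseSeq (Lp ℝ p P₀)) fun i => ?_
    set φ := TopologicalSpace.denseSeq (Lp ℝ p P₀) i
    have heq : ∀ h, dist (hZp h).toLp φ =
        ((∫⁻ x, ‖Z h x - φ x‖ₑ ^ p.toReal ∂P₀) ^ (1 / p.toReal)).toReal := fun h => by
      rw [Lp.dist_def, ← eLpNorm_eq_lintegral_rpow_enorm_toReal hp0 hp]
      congr 1
      exact eLpNorm_congr_ae ((hZp h).coeFn_toLp.sub (EventuallyEq.refl _ _))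
    simp only [heq]
    refine Measurable.ennreal_toReal (Measurable.pow_const ?_ _)
    refine Measurable.lintegral_prod_right' (f := fun q : H × X =>
      ‖Z q.1 q.2 - φ q.2‖ₑ ^ p.toReal) ?_
    exact (hZ.sub ((Lp.stronglyMeasurable φ).measurable.comp measurable_snd)).enorm.pow_const _
  have h2 : Measurable (Function.uncurry fun (φ : Lp ℝ p P₀) h => F h φ) :=
    measurable_uncurry_of_continuous_of_measurable hFc hFm
  exact h2.comp (h1.prodMk measurable_id)

end Lp

/-! ### Dual representation of coherent measures of risk -/

section Coherent

variable {X : Type*} [MeasurableSpace X] {p : ℝ≥0∞} {P₀ : Measure X}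

theorem RiskMDP.IsCoherent.isSublinear [IsFiniteMeasure P₀] {ρ : Lp ℝ p P₀ → ℝ}
    (h : IsCoherent ρ) : IsSublinear ρ := by
  refine ⟨fun φ ψ => ?_, fun b φ hb => h.pos_homogeneous b φ hb.le⟩
  have h1 := h.convex (1 / 2) ((2 : ℝ) • φ) ((2 : ℝ) • ψ) (by norm_num) (by norm_num)
  rw [h.pos_homogeneous _ _ zero_le_two, h.pos_homogeneous _ _ zero_le_two] at h1
  have h2 : (1 / 2 : ℝ) • (2 : ℝ) • φ + (1 - 1 / 2 : ℝ) • (2 : ℝ) • ψ = φ + ψ := by module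
  rw [h2] at h1
  linarith

theorem RiskMDP.IsCoherent.map_const [IsFiniteMeasure P₀] {ρ : Lp ℝ p P₀ → ℝ}
    (h : IsCoherent ρ) (a : ℝ) : ρ (Lp.const p P₀ a) = a := by
  have := h.translation a 0
  rwa [add_zero, h.isSublinear.map_zero, add_zero] at this

variable [Fact (1 ≤ p)]

/-- The maximum in the dual representation of a measurable family of coherent measures of risk is
attained at a kernel. -/
theorem exists_kernel_integral_eq [IsProbabilityMeasure P₀]
    [MeasurableSpace.CountablyGenerated X] (hp : p ≠ ∞) {T : Type*} [MeasurableSpace T]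
    {ρ : T → Lp ℝ p P₀ → ℝ} (hρ : ∀ t, IsCoherent (ρ t)) (hcont : ∀ t, Continuous (ρ t))
    (hmeas : ∀ φ, Measurable fun t => ρ t φ) (φ₀ : Lp ℝ p P₀) :
    ∃ M : Kernel T X, (∀ t, InDual p P₀ (M t)) ∧
      (∀ t (φ : Lp ℝ p P₀), ∫ y, φ y ∂M t ≤ ρ t φ) ∧ ∀ t, ∫ y, φ₀ y ∂M t = ρ t φ₀ := by
  have : Fact (p ≠ ∞) := ⟨hp⟩
  obtain ⟨ℓ, hℓc, hℓle, hℓeq, hℓm⟩ :=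
    exists_measurable_linear_le ρ (fun t => (hρ t).isSublinear) hcont hmeas φ₀
  have hex : ∀ t, ∃ μ : DualProb p P₀, ∀ φ : Lp ℝ p P₀, ∫ y, φ y ∂μ.1 = ℓ t φ := fun t => by
    refine exists_dualProb_of_linear hp (ℓ t) (hℓc t) (fun φ hφ => ?_) (le_antisymm ?_ ?_)
    · have h1 := (hℓle t (-φ)).trans ((hρ t).mono (-φ) 0 (neg_nonpos.2 hφ))
      rw [map_neg, (hρ t).isSublinear.map_zero] at h1
      linarith
    · exact (hℓle t _).trans_eq ((hρ t).map_const 1)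
    · have h1 := (hℓle t (Lp.const p P₀ (-1))).trans_eq ((hρ t).map_const (-1))
      rw [map_neg (Lp.const p P₀), map_neg] at h1
      linarith
  choose μ hμ using hex
  refine ⟨⟨fun t => (μ t).1, Measure.measurable_of_measurable_coe _ fun B hB => ?_⟩,
    fun t => (μ t).2, fun t φ => (hμ t φ).trans_le (hℓle t φ), fun t => (hμ t φ₀).trans (hℓeq t)⟩
  have heq : ∀ t, (μ t).1 B =
      ENNReal.ofReal (ℓ t (indicatorConstLp p hB (measure_ne_top P₀ B) 1)) := fun t => by
    have := (μ t).2.1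
    rw [← hμ t, integral_congr_ae ((μ t).2.2.1.ae_le indicatorConstLp_coeFn),
      integral_indicator_const _ hB, smul_eq_mul, mul_one, measureReal_def,
      ENNReal.ofReal_toReal (measure_ne_top _ _)]
  simp only [heq]
  exact (hℓm _).ennreal_ofReal

variable {σ : Lp ℝ p P₀ → X → DualProb p P₀ → ℝ}

omit [Fact (1 ≤ p)] in
theorem mem_riskSet_iff [IsFiniteMeasure P₀] {x : X} {m μ : DualProb p P₀}
    (h : IsCoherent fun φ => σ φ x m) :
    μ ∈ riskSet σ x m ↔ ∀ φ : Lp ℝ p P₀, ∫ y, φ y ∂μ.1 ≤ σ φ x m := by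
  have h0 : σ 0 x m = 0 := h.isSublinear.map_zero
  simp [riskSet, h0]

theorem exists_mem_riskSet_integral_eq [IsProbabilityMeasure P₀]
    [MeasurableSpace.CountablyGenerated X] (hp : p ≠ ∞) {x : X} {m : DualProb p P₀}
    (h : IsCoherent fun φ => σ φ x m) (hcont : Continuous fun φ => σ φ x m) (φ : Lp ℝ p P₀) :
    ∃ μ ∈ riskSet σ x m, ∫ y, φ y ∂μ.1 = σ φ x m := by
  obtain ⟨M, hM, hle, heq⟩ := exists_kernel_integral_eq hp (T := Unit) (fun _ => h)
    (fun _ => hcont) (fun _ => measurable_const) φ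
  exact ⟨⟨M (), hM ()⟩, (mem_riskSet_iff h).2 fun ψ => hle () ψ, heq ()⟩

/-- Under (G2) and the dual representation, `σ(φ, ·, ·)` is lower semicontinuous. -/
theorem eventually_lt_of_riskSetLowerSemicontinuous [TopologicalSpace X] [IsProbabilityMeasure P₀]
    [MeasurableSpace.CountablyGenerated X] (hp : p ≠ ∞)
    (hcoh : ∀ x m, IsCoherent fun φ => σ φ x m) (hcont : ∀ x m, Continuous fun φ => σ φ x m)
    (hG2 : RiskSetLowerSemicontinuous σ) {x : ℕ → X} {m : ℕ → DualProb p P₀} {x₀ : X}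
    {m₀ : DualProb p P₀} (hx : Tendsto x atTop (𝓝 x₀)) (hm : Tendsto m atTop (𝓝 m₀))
    {φ : Lp ℝ p P₀} {a : ℝ} (ha : a < σ φ x₀ m₀) : ∀ᶠ k in atTop, a < σ φ (x k) (m k) := by
  obtain ⟨μ, hμ, hμφ⟩ := exists_mem_riskSet_integral_eq hp (hcoh x₀ m₀) (hcont x₀ m₀) φ
  have hO : IsOpen {ν : DualProb p P₀ | a < ∫ y, φ y ∂ν.1} := by
    have hc : Continuous fun (ν : DualProb p P₀) (φ : Lp ℝ p P₀) => ∫ y, φ y ∂ν.1 :=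
      continuous_induced_dom
    exact isOpen_lt continuous_const ((continuous_apply φ).comp hc)
  refine (hG2 x m x₀ m₀ hx hm _ hO ⟨μ, hμ, ha.trans_eq hμφ.symm⟩).mono ?_
  rintro k ⟨ν, hν, hνO⟩
  exact lt_of_lt_of_le hνO ((mem_riskSet_iff (hcoh _ _)).1 hν φ)

end Coherent

/-! ### Averaging a measure over the level sets of a simple function -/

section LevelAverage

variable {X : Type*} [MeasurableSpace X] {P₀ m : Measure X}

/-- The measure that gives every level set of `s` the same mass as `m` and is proportional to `P₀`
on it. -/
noncomputable def levelAverage (P₀ : Measure X) (s : SimpleFunc X ℝ) (m : Measure X) : Measure X :=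
  P₀.withDensity (s.map fun r => m (s ⁻¹' {r}) / P₀ (s ⁻¹' {r}))

theorem levelAverage_preimage [IsFiniteMeasure P₀] (hm : m ≪ P₀) (s : SimpleFunc X ℝ) (S : Set ℝ) :
    levelAverage P₀ s m (s ⁻¹' S) = m (s ⁻¹' S) := by
  classical
  have h1 : ∀ (ν : Measure X) (g : ℝ → ℝ≥0∞), ∫⁻ x in s ⁻¹' S, g (s x) ∂ν =
      ∑ r ∈ s.range, S.indicator g r * ν (s ⁻¹' {r}) := fun ν g => by
    rw [← lintegral_indicator (s.measurableSet_preimage S), ← SimpleFunc.map_lintegral,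
      ← SimpleFunc.lintegral_eq_lintegral]
    rfl
  have h2 := h1 m 1
  simp only [Pi.one_apply, setLIntegral_one] at h2
  rw [levelAverage, withDensity_apply _ (s.measurableSet_preimage S), h2]
  refine (h1 P₀ fun r => m (s ⁻¹' {r}) / P₀ (s ⁻¹' {r})).trans (Finset.sum_congr rfl fun r _ => ?_)
  by_cases hr : r ∈ S
  · simp only [indicator_of_mem hr, Pi.one_apply, one_mul]
    by_cases h0 : P₀ (s ⁻¹' {r}) = 0
    · rw [h0, mul_zero, hm h0]
    · exact ENNReal.div_mul_cancel h0 (measure_ne_top _ _)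
  · simp [indicator_of_notMem hr]

theorem inDual_levelAverage [IsFiniteMeasure P₀] [IsProbabilityMeasure m] (p : ℝ≥0∞) (hm : m ≪ P₀)
    (s : SimpleFunc X ℝ) : InDual p P₀ (levelAverage P₀ s m) := by
  refine ⟨⟨?_⟩, withDensity_absolutelyContinuous _ _, ?_⟩
  · have := levelAverage_preimage hm s univ
    rwa [preimage_univ, measure_univ (μ := m)] at this
  · have h1 := Measure.rnDeriv_withDensity P₀
      (s.map fun r => m (s ⁻¹' {r}) / P₀ (s ⁻¹' {r})).measurable
    have h2 := SimpleFunc.memLp_of_isFiniteMeasure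
      (s.map fun r => (m (s ⁻¹' {r}) / P₀ (s ⁻¹' {r})).toReal) (ENNReal.conjExponent p) P₀
    refine h2.ae_eq ?_
    filter_upwards [h1] with y hy
    rw [levelAverage, hy]
    rfl

/-- The average over level sets as an element of `𝓜`. -/
noncomputable def levelAverageDual [IsFiniteMeasure P₀] [IsProbabilityMeasure m] (p : ℝ≥0∞)
    (hm : m ≪ P₀) (s : SimpleFunc X ℝ) : DualProb p P₀ :=
  ⟨levelAverage P₀ s m, inDual_levelAverage p hm s⟩

theorem integral_levelAverage [IsFiniteMeasure P₀] [IsFiniteMeasure m] (hm : m ≪ P₀)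
    (s : SimpleFunc X ℝ) {ψ : X → ℝ} (hψ : Integrable ψ P₀) :
    ∫ y, ψ y ∂levelAverage P₀ s m =
      ∑ r ∈ s.range, (m (s ⁻¹' {r}) / P₀ (s ⁻¹' {r})).toReal * ∫ y in s ⁻¹' {r}, ψ y ∂P₀ := by
  have hfin : ∀ r, m (s ⁻¹' {r}) / P₀ (s ⁻¹' {r}) < ∞ := fun r => by
    by_cases h0 : P₀ (s ⁻¹' {r}) = 0
    · simp [h0, hm h0]
    · exact ENNReal.div_lt_top (measure_ne_top _ _) h0
  rw [levelAverage, integral_withDensity_eq_integral_toReal_smul (SimpleFunc.measurable _)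
    (ae_of_all _ fun y => hfin _)]
  have h1 : ∀ y, ((s.map fun r => m (s ⁻¹' {r}) / P₀ (s ⁻¹' {r})) y).toReal • ψ y =
      ∑ r ∈ s.range, (s ⁻¹' {r}).indicator
        (fun y => (m (s ⁻¹' {r}) / P₀ (s ⁻¹' {r})).toReal * ψ y) y := fun y => by
    rw [Finset.sum_eq_single_of_mem (s y) (s.mem_range_self y)]
    · simp
    · intro r _ hr
      exact indicator_of_notMem (show y ∉ s ⁻¹' {r} from fun h => hr (Eq.symm h)) _
  simp only [h1]
  rw [integral_finsetSum _ fun r _ =>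
    (hψ.const_mul _).indicator (s.measurableSet_preimage {r})]
  refine Finset.sum_congr rfl fun r _ => ?_
  rw [integral_indicator (s.measurableSet_preimage {r}), integral_const_mul]

/-- Setwise convergence of measures makes their averages over the level sets of a fixed simple
function converge weakly*. -/
theorem tendsto_levelAverage [IsProbabilityMeasure P₀] {p : ℝ≥0∞} [Fact (1 ≤ p)]
    (s : SimpleFunc X ℝ) {m : ℕ → Measure X} {m₀ : Measure X} [∀ k, IsProbabilityMeasure (m k)]
    [IsProbabilityMeasure m₀] (hm : ∀ k, m k ≪ P₀) (hm₀ : m₀ ≪ P₀)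
    (h : ∀ B, MeasurableSet B → Tendsto (fun k => m k B) atTop (𝓝 (m₀ B))) :
    Tendsto (fun k => levelAverageDual p (hm k) s) atTop (𝓝 (levelAverageDual p hm₀ s)) := by
  have hind : Topology.IsInducing fun (ν : DualProb p P₀) (φ : Lp ℝ p P₀) => ∫ y, φ y ∂ν.1 := ⟨rfl⟩
  rw [hind.tendsto_nhds_iff, tendsto_pi_nhds]
  intro ψ
  have hψ : Integrable ψ P₀ := (Lp.memLp ψ).integrable Fact.out
  have hi : ∀ k, ∫ y, ψ y ∂levelAverage P₀ s (m k) = _ := fun k =>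
    integral_levelAverage (hm k) s hψ
  change Tendsto (fun k => ∫ y, ψ y ∂levelAverage P₀ s (m k)) atTop
    (𝓝 (∫ y, ψ y ∂levelAverage P₀ s m₀))
  simp only [hi, integral_levelAverage hm₀ s hψ]
  refine tendsto_finsetSum _ fun r _ => Tendsto.mul_const _ ?_
  by_cases h0 : P₀ (s ⁻¹' {r}) = 0
  · simp [hm _ h0, hm₀ h0]
  · exact (ENNReal.tendsto_toReal (ENNReal.div_lt_top (measure_ne_top _ _) h0).ne).comp
      (ENNReal.Tendsto.div_const (h _ (s.measurableSet_preimage {r})) (Or.inr h0))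

end LevelAverage

/-! ### The one-step risk of a controlled transition -/

namespace RiskMDP.Model

variable {X 𝒰 : Type*} [TopologicalSpace X] [MeasurableSpace X] [TopologicalSpace 𝒰]
  [MeasurableSpace 𝒰] {p : ℝ≥0∞} [Fact (1 ≤ p)] {P₀ : Measure X} [IsProbabilityMeasure P₀]

/-- The standing assumptions on the model, apart from risk-transience. The field `continuous` is
norm continuity in the first argument of `σ`. -/
structure Standing (D : Model X 𝒰) (w : X → ℝ) (σ : Lp ℝ p P₀ → X → DualProb p P₀ → ℝ) :
    Prop where
  ne_top : p ≠ ∞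
  weight : IsWeight p P₀ w
  coherent : ∀ x m, IsCoherent fun φ => σ φ x m
  continuous : ∀ x m, Continuous fun φ => σ φ x m
  law : LawInvariant σ
  dual : D.CondG0 p P₀
  setwise : D.CondG1
  riskSet_lsc : RiskSetLowerSemicontinuous σ
  cost : D.CondG3 w
  compact : D.CondG4
  cost_nonneg : ∀ x, ∀ u ∈ D.U x, ∀ y, 0 ≤ D.c x u y

/-- The risk `σ(φ, x, Q(x, u))` of a function `φ` of the next state at the point `z = (x, u)` of
the graph of `U`. -/
noncomputable def oneStep (D : Model X 𝒰) (σ : Lp ℝ p P₀ → X → DualProb p P₀ → ℝ)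
    (z : {z : X × 𝒰 // z.2 ∈ D.U z.1}) (φ : X → ℝ) : ℝ :=
  riskEval σ φ z.1.1 (D.Q z)

namespace Standing

variable {D : Model X 𝒰} {w : X → ℝ} {σ : Lp ℝ p P₀ → X → DualProb p P₀ → ℝ}
  {z : {z : X × 𝒰 // z.2 ∈ D.U z.1}} {φ ψ : X → ℝ}

theorem inDual (S : D.Standing w σ) (z : {z : X × 𝒰 // z.2 ∈ D.U z.1}) : InDual p P₀ (D.Q z) :=
  S.dual z

/-- The transition probability `Q(x, u)` as an element of `𝓜`. -/
def dualQ (S : D.Standing w σ) (z : {z : X × 𝒰 // z.2 ∈ D.U z.1}) : DualProb p P₀ :=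
  ⟨D.Q z, S.inDual z⟩

theorem oneStep_eq (S : D.Standing w σ) (z : {z : X × 𝒰 // z.2 ∈ D.U z.1}) (hφ : MemLp φ p P₀) :
    D.oneStep σ z φ = σ hφ.toLp z.1.1 (S.dualQ z) :=
  dif_pos ⟨hφ, S.inDual z⟩

theorem oneStep_mono (S : D.Standing w σ) (hφ : MemLp φ p P₀) (hψ : MemLp ψ p P₀)
    (h : ∀ y, φ y ≤ ψ y) : D.oneStep σ z φ ≤ D.oneStep σ z ψ := by
  rw [S.oneStep_eq z hφ, S.oneStep_eq z hψ]
  refine (S.coherent _ _).mono _ _ ((Lp.coeFn_le _ _).1 ?_)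
  filter_upwards [hφ.coeFn_toLp, hψ.coeFn_toLp] with y h1 h2
  rw [h1, h2]
  exact h y

theorem oneStep_zero (S : D.Standing w σ) : D.oneStep σ z 0 = 0 := by
  rw [S.oneStep_eq z MemLp.zero]
  exact (S.coherent _ _).isSublinear.map_zero

theorem oneStep_nonneg (S : D.Standing w σ) (hφ : MemLp φ p P₀) (h : ∀ y, 0 ≤ φ y) :
    0 ≤ D.oneStep σ z φ :=
  S.oneStep_zero.symm.trans_le (S.oneStep_mono MemLp.zero hφ h)

theorem oneStep_const_add (S : D.Standing w σ) (hφ : MemLp φ p P₀) (a : ℝ) :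
    D.oneStep σ z (fun y => a + φ y) = a + D.oneStep σ z φ := by
  rw [S.oneStep_eq z hφ]
  exact (S.oneStep_eq z ((memLp_const a).add hφ)).trans ((S.coherent _ _).translation a hφ.toLp)

theorem oneStep_const_mul (S : D.Standing w σ) (hφ : MemLp φ p P₀) {b : ℝ} (hb : 0 ≤ b) :
    D.oneStep σ z (fun y => b * φ y) = b * D.oneStep σ z φ := by
  rw [S.oneStep_eq z hφ]
  exact (S.oneStep_eq z (hφ.const_smul b)).trans
    ((S.coherent _ _).pos_homogeneous b hφ.toLp hb)

/-- At the absorbing state the next state is deterministic, and law invariance identifies `φ` with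
the constant `φ x_A`. -/
theorem oneStep_absorbing (S : D.Standing w σ) [MeasurableSingletonClass X]
    (hz : z.1.1 = D.xA) (hφ : MemLp φ p P₀) : D.oneStep σ z φ = φ D.xA := by
  rw [S.oneStep_eq z hφ, S.law _ (Lp.const p P₀ (φ D.xA)) _ (S.dualQ z) _ _]
  · exact (S.coherent _ _).map_const _
  intro η
  have hprob := (S.inDual z).1
  have hQ : ∀ᵐ y ∂D.Q z, y = D.xA := by
    obtain ⟨⟨x, u⟩, hu⟩ := z
    obtain rfl : x = D.xA := hz
    exact (mem_ae_iff_prob_eq_one (measurableSet_singleton D.xA)).2 (D.Q_absorbing u hu)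
  refine measure_congr (Filter.eventuallyEq_set.2 ?_)
  filter_upwards [hQ, (S.inDual z).2.1.ae_le hφ.coeFn_toLp,
    (S.inDual z).2.1.ae_le (Lp.coeFn_const p P₀ (φ D.xA))] with y h1 h2 h3
  rw [h2, h3, Function.const_apply, h1]

theorem tendsto_oneStep (S : D.Standing w σ) {f : ℕ → X → ℝ} {F : X → ℝ}
    (hf : ∀ n, MemLp (f n) p P₀) (hφ : MemLp φ p P₀) (hF : MemLp F p P₀)
    (hb : ∀ n x, |f n x| ≤ F x) (hlim : ∀ x, Tendsto (fun n => f n x) atTop (𝓝 (φ x))) :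
    Tendsto (fun n => D.oneStep σ z (f n)) atTop (𝓝 (D.oneStep σ z φ)) := by
  simp only [S.oneStep_eq z (hf _), S.oneStep_eq z hφ]
  exact ((S.continuous _ _).tendsto _).comp
    (tendsto_toLp_of_dominated S.ne_top hf hφ hF hb hlim)

variable [MeasurableSpace.CountablyGenerated X]

/-- For simple functions the one-step risk is lower semicontinuous in the state and the control.
The kernel `Q` need not be weakly* continuous, but by law invariance `Q(x, u)` can be replaced by
its average over the level sets of `s`, which depends weakly* continuously on `(x, u)`. -/
theorem lowerSemicontinuous_oneStep_simple (S : D.Standing w σ) [SecondCountableTopology X]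
    [SecondCountableTopology 𝒰] (s : SimpleFunc X ℝ) :
    LowerSemicontinuous fun z => D.oneStep σ z s := by
  have hs : MemLp s p P₀ := s.memLp_of_isFiniteMeasure p P₀
  have hprob : ∀ z, IsProbabilityMeasure (D.Q z) := fun z => (S.inDual z).1
  have hac : ∀ z, D.Q z ≪ P₀ := fun z => (S.inDual z).2.1
  have heq : ∀ z, D.oneStep σ z s =
      σ hs.toLp z.1.1 (levelAverageDual p (hac z) s) := fun z => by
    rw [S.oneStep_eq z hs]
    refine S.law _ _ _ _ (fun η => ?_) _
    have h1 : ∀ ν : Measure X, ν ≪ P₀ →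
        ν {y | (hs.toLp : Lp ℝ p P₀) y ≤ η} = ν (s ⁻¹' Iic η) := fun ν hν => by
      refine measure_congr (Filter.eventuallyEq_set.2 ?_)
      filter_upwards [hν.ae_le hs.coeFn_toLp] with y hy
      simp [hy]
    refine (h1 _ (hac z)).trans (Eq.trans ?_ (h1 _ (levelAverageDual p (hac z) s).2.2.1).symm)
    exact (levelAverage_preimage (hac z) s (Iic η)).symm
  have : SecondCountableTopology {z : X × 𝒰 // z.2 ∈ D.U z.1} :=
    Topology.IsInducing.secondCountableTopology (f := Subtype.val) ⟨rfl⟩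
  intro z a ha
  refine Filter.eventually_iff_seq_eventually.2 fun ζ hζ => ?_
  simp only [heq] at ha ⊢
  refine eventually_lt_of_riskSetLowerSemicontinuous S.ne_top S.coherent S.continuous S.riskSet_lsc
    ?_ (tendsto_levelAverage s (fun k => hac (ζ k)) (hac z) fun B hB =>
      ((S.setwise B hB).tendsto z).comp hζ) ha
  exact ((continuous_fst.comp continuous_subtype_val).tendsto z).comp hζ

theorem lowerSemicontinuous_oneStep (S : D.Standing w σ) [SecondCountableTopology X]
    [SecondCountableTopology 𝒰] (hφm : Measurable φ) (hφ : MemLp φ p P₀) (h0 : ∀ y, 0 ≤ φ y) :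
    LowerSemicontinuous fun z => D.oneStep σ z φ := by
  let s : ℕ → SimpleFunc X ℝ := fun n =>
    (SimpleFunc.eapprox (fun y => ENNReal.ofReal (φ y)) n).map ENNReal.toReal
  have hs : ∀ n, MemLp (s n) p P₀ := fun n => (s n).memLp_of_isFiniteMeasure p P₀
  have hle : ∀ n y, s n y ≤ φ y := fun n y => by
    refine ENNReal.toReal_le_of_le_ofReal (h0 y) ?_
    have := SimpleFunc.iSup_eapprox_apply (f := fun y => ENNReal.ofReal (φ y))
      hφm.ennreal_ofReal y
    exact (le_iSup (fun n => SimpleFunc.eapprox (fun y => ENNReal.ofReal (φ y)) n y) n).trans_eq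
      this
  have hlim : ∀ y, Tendsto (fun n => s n y) atTop (𝓝 (φ y)) := fun y => by
    have := (ENNReal.tendsto_toReal ENNReal.ofReal_ne_top).comp
      (SimpleFunc.tendsto_eapprox (f := fun y => ENNReal.ofReal (φ y)) hφm.ennreal_ofReal y)
    rwa [ENNReal.toReal_ofReal (h0 y)] at this
  intro z a ha
  have ht := S.tendsto_oneStep (z := z) hs hφ hφ (fun n y => by
    exact (abs_of_nonneg (show 0 ≤ s n y from ENNReal.toReal_nonneg)).trans_le (hle n y)) hlim
  obtain ⟨n, hn⟩ := (ht.eventually_const_lt ha).exists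
  exact (S.lowerSemicontinuous_oneStep_simple (s n) z a hn).mono fun z' hz' =>
    hz'.trans_le (S.oneStep_mono (hs n) hφ (hle n))

variable [SecondCountableTopology X] [BorelSpace X] [SecondCountableTopology 𝒰]
  [BorelSpace 𝒰]

theorem measurable_risk (S : D.Standing w σ) (φ : Lp ℝ p P₀) :
    Measurable fun z => σ φ z.1.1 (S.dualQ z) := by
  obtain ⟨ψ, hψ, hlim⟩ := mem_closure_iff_seq_limit.1
    ((Lp.simpleFunc.dense S.ne_top : Dense (Lp.simpleFunc ℝ p P₀ : Set (Lp ℝ p P₀))) φ)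
  refine measurable_of_tendsto_metrizable (fun n => ?_) (tendsto_pi_nhds.2 fun z =>
    ((S.continuous z.1.1 (S.dualQ z)).tendsto φ).comp hlim)
  obtain ⟨s, hs⟩ : ∃ s : SimpleFunc X ℝ, (s.memLp_of_isFiniteMeasure p P₀).toLp = ψ n := by
    let t : Lp.simpleFunc ℝ p P₀ := ⟨ψ n, hψ n⟩
    refine ⟨Lp.simpleFunc.toSimpleFunc t, Lp.ext ?_⟩
    exact (MemLp.coeFn_toLp _).trans (Lp.simpleFunc.toSimpleFunc_eq_toFun t)
  have := (S.lowerSemicontinuous_oneStep_simple s).measurable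
  simp only [S.oneStep_eq _ (s.memLp_of_isFiniteMeasure p P₀), hs] at this
  exact this

/-- Measurability of the one-step risk in parameters, for a family of functions and of points of
the graph of `U`. -/
theorem measurable_oneStep (S : D.Standing w σ) {H : Type*} [MeasurableSpace H]
    {ξ : H → {z : X × 𝒰 // z.2 ∈ D.U z.1}} (hξ : Measurable ξ) {Z : H → X → ℝ}
    (hZ : Measurable fun q : H × X => Z q.1 q.2) (hZp : ∀ h, MemLp (Z h) p P₀) :
    Measurable fun h => D.oneStep σ (ξ h) (Z h) := by
  simp only [fun h => S.oneStep_eq (ξ h) (hZp h)]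
  exact measurable_comp_toLp S.ne_top (F := fun h φ => σ φ (ξ h).1.1 (S.dualQ (ξ h)))
    (fun h => S.continuous _ _) (fun φ => (S.measurable_risk φ).comp hξ) hZ hZp

end Standing

end RiskMDP.Model

namespace RiskMDP.Model

variable {X 𝒰 : Type*} [TopologicalSpace X] [SecondCountableTopology X]
  [MeasurableSpace X] [BorelSpace X] [MeasurableSpace.CountablyGenerated X]
  [TopologicalSpace 𝒰] [SecondCountableTopology 𝒰] [MeasurableSpace 𝒰] [BorelSpace 𝒰]
  {p : ℝ≥0∞} [Fact (1 ≤ p)] {P₀ : Measure X} [IsProbabilityMeasure P₀]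
  {D : Model X 𝒰} {w : X → ℝ} {σ : Lp ℝ p P₀ → X → DualProb p P₀ → ℝ}

/-! ### The dynamic programming operator -/

/-- The point of the graph of `U` over `x` chosen by the decision rule `π`. -/
def Rule.pt (π : D.Rule) (x : X) : {z : X × 𝒰 // z.2 ∈ D.U z.1} := ⟨(x, π.toFun x), π.mem x⟩

omit [TopologicalSpace X] [SecondCountableTopology X] [BorelSpace X]
  [MeasurableSpace.CountablyGenerated X] [SecondCountableTopology 𝒰] [BorelSpace 𝒰] in
theorem Rule.measurable_pt (π : D.Rule) : Measurable π.pt :=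
  (measurable_id.prodMk π.measurable).subtype_mk

/-- The point of the graph of `U` reached by the policy `Λ` at time `t` after the history `h`. -/
def Policy.pt (Λ : D.Policy) (t : ℕ) (h : Fin (t + 1) → X) :
    {z : X × 𝒰 // z.2 ∈ D.U z.1} := ⟨(h (Fin.last t), Λ.toFun t h), Λ.mem t h⟩

omit [TopologicalSpace X] [SecondCountableTopology X] [BorelSpace X]
  [MeasurableSpace.CountablyGenerated X] [SecondCountableTopology 𝒰] [BorelSpace 𝒰]
  [Fact (1 ≤ p)] [IsProbabilityMeasure P₀] in
/-- The recursion of the nested risk, with the stage cost written out. -/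
theorem tailRisk_succ (Λ : D.Policy) (n t : ℕ) (h : Fin (t + 1) → X) :
    D.tailRisk σ Λ (n + 1) t h = D.oneStep σ (Λ.pt t h) fun y =>
      D.c (h (Fin.last t)) (Λ.toFun t h) y + D.tailRisk σ Λ n (t + 1) (Fin.snoc h y) := by
  rw [tailRisk, condRisk, oneStep]
  congr 1
  funext y
  simp [stageCost, Fin.init_snoc]

/-- Functions that a value function in this problem may be: measurable, nonnegative and bounded by
a multiple of the weight function. -/
structure IsBoundedValue (w : X → ℝ) (v : X → ℝ) : Prop where
  measurable : Measurable v
  nonneg : ∀ x, 0 ≤ v x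
  bounded : ∃ B : ℝ, ∀ x, v x ≤ B * w x

namespace Standing

omit [SecondCountableTopology X] [BorelSpace X] [MeasurableSpace.CountablyGenerated X]
  [SecondCountableTopology 𝒰] [BorelSpace 𝒰]

theorem w_pos (S : D.Standing w σ) (x : X) : 0 < w x := zero_lt_one.trans_le (S.weight.one_le x)

theorem memLp_of_le (S : D.Standing w σ) {f : X → ℝ} (hf : Measurable f) (h0 : ∀ x, 0 ≤ f x)
    {a B : ℝ} (hB : ∀ x, f x ≤ a + B * w x) : MemLp f p P₀ := by
  refine ((memLp_const a).add (S.weight.memLp.const_mul B)).mono' hf.aestronglyMeasurable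
    (ae_of_all _ fun x => ?_)
  rw [Real.norm_eq_abs, abs_of_nonneg (h0 x)]
  exact hB x

theorem memLp (S : D.Standing w σ) {v : X → ℝ} (hv : IsBoundedValue w v) : MemLp v p P₀ := by
  obtain ⟨B, hB⟩ := hv.bounded
  exact S.memLp_of_le hv.measurable hv.nonneg (a := 0) (B := B) fun x => by simpa using hB x

theorem measurable_cost (S : D.Standing w σ) (z : X × 𝒰) : Measurable fun y => D.c z.1 z.2 y :=
  S.cost.measurable.comp
    (f := fun y => (z.1, z.2, y)) (measurable_const.prodMk (measurable_const.prodMk measurable_id))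

theorem exists_cost_le (S : D.Standing w σ) : ∃ C : ℝ, 0 < C ∧
    ∀ z : {z : X × 𝒰 // z.2 ∈ D.U z.1}, ∀ y, D.c z.1.1 z.1.2 y ≤ C * w z.1.1 + C * w y := by
  obtain ⟨C, hC, h⟩ := S.cost.bounded
  exact ⟨C, hC, fun z y => (le_abs_self _).trans ((h _ _ z.2 y).trans_eq (mul_add _ _ _))⟩

theorem memLp_cost_add (S : D.Standing w σ) (z : {z : X × 𝒰 // z.2 ∈ D.U z.1}) {v : X → ℝ}
    (hv : MemLp v p P₀) : MemLp (fun y => D.c z.1.1 z.1.2 y + v y) p P₀ := by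
  obtain ⟨C, _, h⟩ := S.exists_cost_le
  exact (S.memLp_of_le (S.measurable_cost z.1) (fun y => S.cost_nonneg _ _ z.2 y)
    (fun y => h z y)).add hv

theorem lintegral_weight_le (S : D.Standing w σ) {K : ℝ≥0}
    {M : Kernel {x : X // x ≠ D.xA} {x : X // x ≠ D.xA}}
    (hM : kernelNorm (fun x => w x.1) M ≤ K) (x : {x : X // x ≠ D.xA}) :
    ∫⁻ y, ENNReal.ofReal (w y.1) ∂M x ≤ K * ENNReal.ofReal (w x.1) := by
  have h1 := (le_iSup (fun x : {x : X // x ≠ D.xA} =>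
    (∫⁻ y, ENNReal.ofReal (w y.1) ∂(M x)) / ENNReal.ofReal (w x.1)) x).trans hM
  refine (ENNReal.div_le_iff ?_ ENNReal.ofReal_ne_top).1 h1
  simpa using S.w_pos x.1

theorem oneStep_weight_add_le (S : D.Standing w σ) {K : ℝ}
    (hK : ∀ z, D.oneStep σ z w ≤ K * w z.1.1) {C B : ℝ} (hC : 0 ≤ C) (hB : 0 ≤ B)
    {z : {z : X × 𝒰 // z.2 ∈ D.U z.1}} {f : X → ℝ} (hf : MemLp f p P₀)
    (h : ∀ y, f y ≤ C * w z.1.1 + (C + B) * w y) :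
    D.oneStep σ z f ≤ (C + (C + B) * K) * w z.1.1 := by
  have hCB : 0 ≤ C + B := add_nonneg hC hB
  have h1 := S.oneStep_mono (z := z) hf
    ((memLp_const (C * w z.1.1)).add (S.weight.memLp.const_mul (C + B))) h
  have h2 := S.oneStep_const_add (z := z) (S.weight.memLp.const_mul (C + B)) (C * w z.1.1)
  rw [S.oneStep_const_mul S.weight.memLp hCB] at h2
  have h3 := mul_le_mul_of_nonneg_left (hK z) hCB
  have h4 := h1.trans_eq h2
  linarith

theorem isBoundedValue_weight_add (S : D.Standing w σ) {C : ℝ} (hC : 0 ≤ C) {v : X → ℝ}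
    (hv : IsBoundedValue w v) : IsBoundedValue w fun y => C * w y + v y := by
  obtain ⟨B, hB⟩ := hv.bounded
  exact ⟨(S.weight.measurable.const_mul C).add hv.measurable,
    fun y => add_nonneg (mul_nonneg hC (S.w_pos y).le) (hv.nonneg y), C + B,
    fun y => by rw [add_mul]; exact add_le_add_right (hB y) _⟩

/-- Approaching the point `z` along `ζ`, the costs `c(ζ k, ·)` are eventually not much below
`c(z, ·)`; their tail infima, cut off at `c(z, ·)`, increase to `c(z, ·)`. -/
theorem lowerSemicontinuous_stepRisk [MeasurableSpace.CountablyGenerated X]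
    [SecondCountableTopology X] [SecondCountableTopology 𝒰] (S : D.Standing w σ)
    {v : X → ℝ} (hv : IsBoundedValue w v) :
    LowerSemicontinuous fun z : {z : X × 𝒰 // z.2 ∈ D.U z.1} =>
      D.oneStep σ z fun y => D.c z.1.1 z.1.2 y + v y := by
  have : SecondCountableTopology {z : X × 𝒰 // z.2 ∈ D.U z.1} :=
    Topology.IsInducing.secondCountableTopology (f := Subtype.val) ⟨rfl⟩
  have hvp := S.memLp hv
  intro z a ha
  refine Filter.eventually_iff_seq_eventually.2 fun ζ hζ => ?_
  have hc0 : ∀ (z : {z : X × 𝒰 // z.2 ∈ D.U z.1}) y, 0 ≤ D.c z.1.1 z.1.2 y := fun z y =>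
    S.cost_nonneg _ _ z.2 y
  let g : ℕ → X → ℝ := fun j y =>
    min (⨅ k, D.c (ζ (j + k)).1.1 (ζ (j + k)).1.2 y) (D.c z.1.1 z.1.2 y)
  have hbdd : ∀ j y, BddBelow (range fun k => D.c (ζ (j + k)).1.1 (ζ (j + k)).1.2 y) :=
    fun j y => ⟨0, by rintro _ ⟨k, rfl⟩; exact hc0 _ y⟩
  have hg0 : ∀ j y, 0 ≤ g j y := fun j y => le_min (le_ciInf fun k => hc0 _ y) (hc0 z y)
  have hgz : ∀ j y, g j y ≤ D.c z.1.1 z.1.2 y := fun j y => min_le_right _ _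
  have hgζ : ∀ j k y, j ≤ k → g j y ≤ D.c (ζ k).1.1 (ζ k).1.2 y := fun j k y hjk => by
    have := ciInf_le (hbdd j y) (k - j)
    simp only [Nat.add_sub_cancel' hjk] at this
    exact (min_le_left _ _).trans this
  have hgm : ∀ j, Measurable (g j) := fun j =>
    (Measurable.iInf fun k => S.measurable_cost _).min (S.measurable_cost z.1)
  have hcz : MemLp (fun y => D.c z.1.1 z.1.2 y) p P₀ := by
    simpa using S.memLp_cost_add z (v := 0) MemLp.zero
  have hgp : ∀ j, MemLp (g j) p P₀ := fun j =>
    hcz.mono' (hgm j).aestronglyMeasurable (ae_of_all _ fun y => by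
      rw [Real.norm_eq_abs, abs_of_nonneg (hg0 j y)]
      exact hgz j y)
  have hglim : ∀ y, Tendsto (fun j => g j y) atTop (𝓝 (D.c z.1.1 z.1.2 y)) := fun y => by
    refine tendsto_order.2 ⟨fun b hb => ?_, fun b hb =>
      Eventually.of_forall fun j => (hgz j y).trans_lt hb⟩
    obtain ⟨b', hb1, hb2⟩ := exists_between hb
    have hval : Tendsto (fun k => (ζ k).1) atTop (𝓝[{z : X × 𝒰 | z.2 ∈ D.U z.1}] z.1) :=
      tendsto_nhdsWithin_iff.2 ⟨(continuous_subtype_val.tendsto z).comp hζ,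
        Eventually.of_forall fun k => (ζ k).2⟩
    obtain ⟨N, hN⟩ := eventually_atTop.1 (hval.eventually (S.cost.lsc y z.1 z.2 b' hb2))
    refine eventually_atTop.2 ⟨N, fun j hj => hb1.trans_le (le_min ?_ hb2.le)⟩
    exact le_ciInf fun k => (hN _ (hj.trans (Nat.le_add_right _ _))).le
  have htend := S.tendsto_oneStep (z := z) (f := fun j y => g j y + v y)
    (fun j => (hgp j).add hvp) (S.memLp_cost_add z hvp) (S.memLp_cost_add z hvp)
    (fun j y => by
      rw [abs_of_nonneg (add_nonneg (hg0 j y) (hv.nonneg y))]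
      exact add_le_add_left (hgz j y) _)
    (fun y => (hglim y).add_const _)
  obtain ⟨j, hj⟩ := (htend.eventually_const_lt ha).exists
  have hlsc := S.lowerSemicontinuous_oneStep ((hgm j).add hv.measurable) ((hgp j).add hvp)
    (fun y => add_nonneg (hg0 j y) (hv.nonneg y)) z a hj
  filter_upwards [hζ.eventually hlsc, eventually_ge_atTop j] with k hk hjk
  exact hk.trans_le (S.oneStep_mono ((hgp j).add hvp) (S.memLp_cost_add _ hvp)
    fun y => add_le_add_left (hgζ j k y hjk) _)

variable [TopologicalSpace.MetrizableSpace X] [SecondCountableTopology X] [BorelSpace X]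
  [MeasurableSpace.CountablyGenerated X]
  [TopologicalSpace.MetrizableSpace 𝒰] [SecondCountableTopology 𝒰] [BorelSpace 𝒰]

/-- The minimum in the dynamic programming operator is attained, by a decision rule. -/
theorem exists_rule_dpOp (S : D.Standing w σ) {v : X → ℝ} (hv : IsBoundedValue w v) :
    Measurable (D.dpOp σ v) ∧
      (∀ z : {z : X × 𝒰 // z.2 ∈ D.U z.1},
        D.dpOp σ v z.1.1 ≤ D.oneStep σ z fun y => D.c z.1.1 z.1.2 y + v y) ∧
      ∃ π : D.Rule, ∀ x,
        (D.oneStep σ (π.pt x) fun y => D.c x (π.toFun x) y + v y) = D.dpOp σ v x := by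
  classical
  have hU : MeasurableCompactMulti D.U := ⟨D.U_nonempty, S.compact, D.U_measurable⟩
  let f : X × 𝒰 → ℝ := fun z => if h : z.2 ∈ D.U z.1 then
    D.oneStep σ ⟨z, h⟩ fun y => D.c z.1 z.2 y + v y else 0
  have hfz : ∀ z : {z : X × 𝒰 // z.2 ∈ D.U z.1},
      f z.1 = D.oneStep σ z fun y => D.c z.1.1 z.1.2 y + v y := fun z => dif_pos z.2
  have hf : LowerSemicontinuousOn f {z | z.2 ∈ D.U z.1} := by
    refine lowerSemicontinuous_restrict_iff.1 ?_
    have : Set.domRestrict {z : X × 𝒰 | z.2 ∈ D.U z.1} f = fun z =>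
        D.oneStep σ z fun y => D.c z.1.1 z.1.2 y + v y := funext fun z => hfz z
    rw [this]
    exact S.lowerSemicontinuous_stepRisk hv
  obtain ⟨g, hg, hle, hΨ⟩ := hU.exists_min hf
  obtain ⟨π, hπ, hmem⟩ := hΨ.exists_measurable_selector
  have hdp : D.dpOp σ v = g := funext fun x => by
    refine IsLeast.csInf_eq ⟨⟨⟨π x, (hmem x).1⟩, ?_⟩, ?_⟩
    · exact (hfz ⟨(x, π x), (hmem x).1⟩).symm.trans (hmem x).2
    · rintro _ ⟨u, rfl⟩
      exact (hle x u u.2).trans_eq (hfz ⟨(x, u), u.2⟩)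
  rw [hdp]
  refine ⟨hg, fun z => (hle _ _ z.2).trans_eq (hfz z), ⟨π, hπ, fun x => (hmem x).1⟩, fun x => ?_⟩
  exact (hfz ⟨(x, π x), (hmem x).1⟩).symm.trans (hmem x).2

omit [MeasurableSpace.CountablyGenerated X] in
theorem nonempty_rule (S : D.Standing w σ) : Nonempty D.Rule :=
  have hU : MeasurableCompactMulti D.U := ⟨D.U_nonempty, S.compact, D.U_measurable⟩
  let ⟨π, hπ, hmem⟩ := hU.exists_measurable_selector
  ⟨⟨π, hπ, hmem⟩⟩

theorem dpOp_nonneg (S : D.Standing w σ) {v : X → ℝ} (hv : IsBoundedValue w v) (x : X) :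
    0 ≤ D.dpOp σ v x := by
  obtain ⟨_, _, π, hπ⟩ := S.exists_rule_dpOp hv
  rw [← hπ x]
  exact S.oneStep_nonneg (S.memLp_cost_add (π.pt x) (S.memLp hv)) fun y =>
    add_nonneg (S.cost_nonneg _ _ (π.mem x) y) (hv.nonneg y)

theorem dpOp_mono (S : D.Standing w σ) {v v' : X → ℝ} (hv : IsBoundedValue w v)
    (hv' : IsBoundedValue w v') (h : ∀ x, v x ≤ v' x) (x : X) :
    D.dpOp σ v x ≤ D.dpOp σ v' x := by
  obtain ⟨_, _, π, hπ⟩ := S.exists_rule_dpOp hv'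
  rw [← hπ x]
  exact ((S.exists_rule_dpOp hv).2.1 (π.pt x)).trans
    (S.oneStep_mono (S.memLp_cost_add (π.pt x) (S.memLp hv))
      (S.memLp_cost_add (π.pt x) (S.memLp hv')) fun y => add_le_add_right (h y) _)

/-- Monotone limits pass through the dynamic programming operator: by compactness of `U(x)` there
is a control that does at least as well as the limit for every function of the sequence. -/
theorem dpOp_le_of_tendsto (S : D.Standing w σ) {v : ℕ → X → ℝ} {g : X → ℝ}
    (hv : ∀ k, IsBoundedValue w (v k)) (hg : IsBoundedValue w g)
    (hmono : ∀ x, Monotone fun k => v k x)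
    (hlim : ∀ x, Tendsto (fun k => v k x) atTop (𝓝 (g x))) {x : X} {a : ℝ}
    (ha : ∀ k, D.dpOp σ (v k) x ≤ a) : D.dpOp σ g x ≤ a := by
  have : CompactSpace (D.U x) := isCompact_iff_compactSpace.1 (S.compact x)
  let F : ℕ → D.U x → ℝ := fun k u => D.stepRisk σ (v k) x u
  have hF : ∀ k, LowerSemicontinuous (F k) := fun k =>
    (S.lowerSemicontinuous_stepRisk (hv k)).comp (g := fun u : D.U x =>
      (⟨(x, u), u.2⟩ : {z : X × 𝒰 // z.2 ∈ D.U z.1}))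
      ((continuous_const.prodMk continuous_subtype_val).subtype_mk _)
  have hle : ∀ k y, v k y ≤ g y := fun k y => (hmono y).ge_of_tendsto (hlim y) k
  have hclosed : ∀ k, IsClosed {u | F k u ≤ a} := fun k => (hF k).isClosed_preimage a
  obtain ⟨u, hu⟩ : (⋂ k, {u | F k u ≤ a}).Nonempty := by
    refine IsCompact.nonempty_iInter_of_sequence_nonempty_isCompact_isClosed _ (fun k u hu => ?_)
      (fun k => ?_) (hclosed 0).isCompact hclosed
    · exact (S.oneStep_mono (S.memLp_cost_add ⟨(x, u), u.2⟩ (S.memLp (hv k)))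
        (S.memLp_cost_add ⟨(x, u), u.2⟩ (S.memLp (hv (k + 1))))
        fun y => add_le_add_right (hmono y k.le_succ) _).trans hu
    · obtain ⟨_, _, π, hπ⟩ := S.exists_rule_dpOp (hv k)
      exact ⟨⟨π.toFun x, π.mem x⟩, (hπ x).trans_le (ha k)⟩
  have hcg := S.memLp_cost_add ⟨(x, u), u.2⟩ (S.memLp hg)
  refine ((S.exists_rule_dpOp hg).2.1 ⟨(x, u), u.2⟩).trans (le_of_tendsto
    (S.tendsto_oneStep (fun k => S.memLp_cost_add ⟨(x, u), u.2⟩ (S.memLp (hv k))) hcg hcg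
      (fun k y => ?_) fun y => (hlim y).const_add _)
    (Eventually.of_forall fun k => mem_iInter.1 hu k))
  rw [abs_of_nonneg (add_nonneg (S.cost_nonneg _ _ u.2 y) ((hv k).nonneg y))]
  exact add_le_add_right (hle k y) _

/-! ### The consequences of risk-transience -/

omit [TopologicalSpace.MetrizableSpace 𝒰] in
/-- The one-step risk under a decision rule, away from the absorbing state, is governed by a
measurable selector of the effective multikernel. -/
theorem exists_selector_oneStep_le (S : D.Standing w σ) (π : D.Rule) {g : X → ℝ}
    (hg : IsBoundedValue w g) :
    ∃ M : Kernel {x : X // x ≠ D.xA} {x : X // x ≠ D.xA},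
      IsSelector M (D.effMultikernel σ π) ∧ ∀ x, ENNReal.ofReal (D.oneStep σ (π.pt x.1) g) ≤
        ENNReal.ofReal (g D.xA) + ∫⁻ y, ENNReal.ofReal (g y.1) ∂M x := by
  have hgp := S.memLp hg
  obtain ⟨M, hM, hle, heq⟩ := exists_kernel_integral_eq S.ne_top
    (ρ := fun x φ => σ φ x (S.dualQ (π.pt x))) (fun x => S.coherent _ _)
    (fun x => S.continuous _ _) (fun φ => (S.measurable_risk φ).comp π.measurable_pt) hgp.toLp
  have hemb : MeasurableEmbedding (Subtype.val : {x : X // x ≠ D.xA} → X) :=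
    MeasurableEmbedding.subtype_coe (measurableSet_singleton D.xA).compl
  refine ⟨(M.comap Subtype.val measurable_subtype_coe).comapRight hemb, fun x => ?_, fun x => ?_⟩
  · refine ⟨S.dualQ (π.pt x.1), ⟨M x.1, hM x.1⟩, rfl, ?_, ?_⟩
    · exact (mem_riskSet_iff (S.coherent _ _)).2 fun φ => hle x.1 φ
    · rw [Kernel.comapRight_apply]
      rfl
  · have hprob := (hM x.1).1
    have h1 : D.oneStep σ (π.pt x.1) g = ∫ y, g y ∂M x.1 := by
      rw [S.oneStep_eq _ hgp]
      exact (heq x.1).symm.trans (integral_congr_ae ((hM x.1).2.1.ae_le hgp.coeFn_toLp))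
    rw [h1, ofReal_integral_eq_lintegral_ofReal ((hM x.1).integrable hgp)
      (ae_of_all _ hg.nonneg), Kernel.comapRight_apply, Kernel.comap_apply]
    have h2 : ∫⁻ y : {x : X // x ≠ D.xA}, ENNReal.ofReal (g y.1) ∂(M x.1).comap Subtype.val =
        ∫⁻ y in {D.xA}ᶜ, ENNReal.ofReal (g y) ∂M x.1 := by
      have hr : range (Subtype.val : {x : X // x ≠ D.xA} → X) = {D.xA}ᶜ := Subtype.range_coe
      rw [← hemb.lintegral_map (fun y => ENNReal.ofReal (g y)), hemb.map_comap, hr]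
    rw [h2, ← lintegral_add_compl _ (measurableSet_singleton D.xA)]
    refine add_le_add_left ?_ _
    rw [lintegral_singleton]
    exact mul_le_of_le_one_right' prob_le_one

/-- Transience with horizon `1`: the one-step risk of the weight function is bounded by a multiple
of the weight function. A given control at a given state is used by some decision rule. -/
theorem exists_oneStep_weight_le (S : D.Standing w σ) (ht : D.UniformlyRiskTransient σ w) :
    ∃ K : ℝ, 0 ≤ K ∧ ∀ z, D.oneStep σ z w ≤ K * w z.1.1 := by
  classical
  obtain ⟨K, hK⟩ := ht
  obtain ⟨π₀⟩ := S.nonempty_rule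
  refine ⟨K + w D.xA, add_nonneg K.2 (S.w_pos _).le, fun z => ?_⟩
  have hKw : 0 ≤ K * w z.1.1 := mul_nonneg K.2 (S.w_pos _).le
  have hAw : w D.xA ≤ w D.xA * w z.1.1 :=
    le_mul_of_one_le_right (S.w_pos _).le (S.weight.one_le _)
  rw [add_mul]
  by_cases hz : z.1.1 = D.xA
  · rw [S.oneStep_absorbing hz S.weight.memLp]
    linarith
  let π : D.Rule :=
    { toFun := fun x => if x = z.1.1 then z.1.2 else π₀.toFun x
      measurable := Measurable.ite (measurableSet_singleton z.1.1) measurable_const π₀.measurable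
      mem := fun x => by
        split_ifs with h
        · exact h ▸ z.2
        · exact π₀.mem x }
  have hpt : π.pt z.1.1 = z := Subtype.ext (Prod.ext rfl (if_pos rfl))
  have hwb : IsBoundedValue w w :=
    ⟨S.weight.measurable, fun x => (S.w_pos x).le, 1, fun x => (one_mul _).ge⟩
  obtain ⟨M, hM, hle⟩ := S.exists_selector_oneStep_le π hwb
  have h1 := hK π 1 M fun x => by simpa [multiPowSum, multiPow] using hM x
  have h2 := (hle ⟨z.1.1, hz⟩).trans
    (add_le_add_right (S.lintegral_weight_le h1 ⟨z.1.1, hz⟩) _)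
  rw [hpt, ← ENNReal.ofReal_coe_nnreal, ← ENNReal.ofReal_mul K.coe_nonneg,
    ← ENNReal.ofReal_add (S.w_pos _).le hKw,
    ENNReal.ofReal_le_ofReal_iff (add_nonneg (S.w_pos _).le hKw)] at h2
  linarith

end Standing

end RiskMDP.Model

/-! ### Products of kernels -/

namespace RiskMDP

variable {S : Type*} [MeasurableSpace S]

/-- The product of the kernels `N 0, …, N j`, of which `N 0` acts first. -/
noncomputable def kernelProd (N : ℕ → Kernel S S) : ℕ → Kernel S S
  | 0 => N 0
  | j + 1 => (N (j + 1)).comp (kernelProd N j)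

theorem kernelProd_succ_eq (N : ℕ → Kernel S S) (j : ℕ) :
    kernelProd N (j + 1) = (kernelProd (fun i => N (i + 1)) j).comp (N 0) := by
  induction j with
  | zero => rfl
  | succ j ih =>
    change (N (j + 1 + 1)).comp (kernelProd N (j + 1)) = _
    rw [ih, ← Kernel.comp_assoc]
    rfl

theorem isSelector_kernelProd {𝔐 : S → Set (Measure S)} {N : ℕ → Kernel S S}
    (hN : ∀ i, IsSelector (N i) 𝔐) (j : ℕ) : IsSelector (kernelProd N j) (multiPow 𝔐 (j + 1)) := by
  induction j with
  | zero => exact hN 0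
  | succ j ih => exact fun x => ⟨_, _, ih, hN (j + 1), rfl⟩

theorem isSelector_sum_kernelProd {𝔐 : S → Set (Measure S)} {N : ℕ → Kernel S S}
    (hN : ∀ i, IsSelector (N i) 𝔐) (T : ℕ) :
    IsSelector (∑ j ∈ Finset.range T, kernelProd N j) (multiPowSum 𝔐 T) := fun x => by
  have h : multiPowSum 𝔐 T x = ∑ j ∈ Finset.range T, multiPow 𝔐 (j + 1) x := by
    rw [multiPowSum, ← Finset.Ico_add_one_right_eq_Icc, Finset.sum_Ico_eq_sum_range,
      Nat.add_sub_cancel]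
    exact Finset.sum_congr rfl fun j _ => by rw [add_comm]
  rw [h, sum_apply]
  exact Set.finsetSum_mem_finsetSum _ _ _ fun j _ => isSelector_kernelProd hN j x

/-- Unrolling the recursion `β (k + 1) ≤ c W + M_k (c W + β k)`. -/
theorem le_sum_lintegral_kernelProd {W : S → ℝ≥0∞} (hW : Measurable W) {M : ℕ → Kernel S S}
    {β : ℕ → S → ℝ≥0∞} {c : ℝ≥0∞} (h0 : ∀ x, β 0 x = 0)
    (h : ∀ k x, β (k + 1) x ≤ c * W x + ∫⁻ y, (c * W y + β k y) ∂M k x) (k : ℕ) (x : S) :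
    β k x ≤ c * W x + 2 * c * ∑ j ∈ Finset.range k,
      ∫⁻ y, W y ∂kernelProd (fun i => M (k - 1 - i)) j x := by
  induction k generalizing x with
  | zero => simp [h0]
  | succ k ih =>
    refine (h k x).trans (add_le_add_right ?_ _)
    set N : ℕ → Kernel S S := fun i => M (k - 1 - i)
    set N' : ℕ → Kernel S S := fun i => M (k + 1 - 1 - i)
    have hNN : (fun i => N' (i + 1)) = N := funext fun i => by
      simp only [N, N', Nat.add_sub_cancel, Nat.sub_sub, add_comm]
    have hN0 : N' 0 = M k := rfl
    have hm : ∀ j, Measurable fun y => ∫⁻ z, W z ∂kernelProd N j y := fun j => hW.lintegral_kernel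
    calc ∫⁻ y, (c * W y + β k y) ∂M k x
        ≤ ∫⁻ y, (2 * c * W y + 2 * c * ∑ j ∈ Finset.range k,
            ∫⁻ z, W z ∂kernelProd N j y) ∂M k x := by
          refine lintegral_mono fun y => (add_le_add_right (ih y) _).trans_eq ?_
          rw [← add_assoc, ← add_mul, ← two_mul]
      _ = 2 * c * ∑ j ∈ Finset.range (k + 1), ∫⁻ y, W y ∂kernelProd N' j x := by
          rw [lintegral_add_left (hW.const_mul _), lintegral_const_mul _ hW,
            lintegral_const_mul _ (Finset.measurable_fun_sum _ fun j _ => hm j),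
            lintegral_finsetSum _ fun j _ => hm j, ← mul_add, Finset.sum_range_succ', add_comm]
          congr 2
          refine Finset.sum_congr rfl fun j _ => ?_
          rw [kernelProd_succ_eq, hNN, hN0, Kernel.lintegral_comp _ _ _ hW]

end RiskMDP

theorem measurable_snoc {X : Type*} [MeasurableSpace X] (t : ℕ) :
    Measurable fun q : (Fin (t + 1) → X) × X => (Fin.snoc q.1 q.2 : Fin (t + 2) → X) := by
  refine measurable_pi_iff.2 fun i => ?_
  induction i using Fin.lastCases with
  | last => simpa using measurable_snd
  | cast i => simpa [Function.comp_def] using (measurable_pi_apply i).comp measurable_fst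

namespace RiskMDP.Model

variable {X 𝒰 : Type*} [TopologicalSpace X] [TopologicalSpace.MetrizableSpace X]
  [SecondCountableTopology X] [MeasurableSpace X] [BorelSpace X]
  [MeasurableSpace.CountablyGenerated X]
  [TopologicalSpace 𝒰] [TopologicalSpace.MetrizableSpace 𝒰] [SecondCountableTopology 𝒰]
  [MeasurableSpace 𝒰] [BorelSpace 𝒰]
  {p : ℝ≥0∞} [Fact (1 ≤ p)] {P₀ : Measure X} [IsProbabilityMeasure P₀]
  {D : Model X 𝒰} {w : X → ℝ} {σ : Lp ℝ p P₀ → X → DualProb p P₀ → ℝ}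

namespace Standing

/-! ### Bounds for the risk of policies and for value iteration -/

omit [TopologicalSpace.MetrizableSpace X] [TopologicalSpace.MetrizableSpace 𝒰] in
/-- With a one-step bound on the risk of the weight function, the nested risk of `n` stage costs
is measurable in the history and bounded by a multiple of the weight of the current state. -/
theorem exists_tailRisk_le (S : D.Standing w σ) {K : ℝ} (hK0 : 0 ≤ K)
    (hK : ∀ z, D.oneStep σ z w ≤ K * w z.1.1) (Λ : D.Policy) (n : ℕ) :
    ∃ B : ℝ, 0 ≤ B ∧ ∀ t, Measurable (D.tailRisk σ Λ n t) ∧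
      ∀ h, 0 ≤ D.tailRisk σ Λ n t h ∧ D.tailRisk σ Λ n t h ≤ B * w (h (Fin.last t)) := by
  obtain ⟨C, hC, hc⟩ := S.exists_cost_le
  induction n with
  | zero => exact ⟨0, le_rfl, fun t => ⟨measurable_const, fun h => by simp [tailRisk]⟩⟩
  | succ n ih =>
    obtain ⟨B, hB, ih⟩ := ih
    have hptm : ∀ t, Measurable (Λ.pt t) := fun t =>
      ((measurable_pi_apply _).prodMk (Λ.measurable t)).subtype_mk
    have hbv : ∀ t h, IsBoundedValue w fun y => D.tailRisk σ Λ n (t + 1) (Fin.snoc h y) :=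
      fun t h => ⟨(ih (t + 1)).1.comp ((measurable_snoc t).comp measurable_prodMk_left),
        fun y => ((ih (t + 1)).2 _).1, B, fun y => by simpa using ((ih (t + 1)).2 (Fin.snoc h y)).2⟩
    have hmem := fun t h => S.memLp_cost_add (Λ.pt t h) (S.memLp (hbv t h))
    refine ⟨C + (C + B) * K, by positivity, fun t => ⟨?_, fun h => ⟨?_, ?_⟩⟩⟩
    · rw [funext (tailRisk_succ Λ n t)]
      refine S.measurable_oneStep (hptm t) (Z := fun h y => D.c (Λ.pt t h).1.1 (Λ.pt t h).1.2 y +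
        D.tailRisk σ Λ n (t + 1) (Fin.snoc h y)) ?_ (hmem t)
      refine Measurable.add ?_ ((ih (t + 1)).1.comp (measurable_snoc t))
      have h1 : Measurable fun q : (Fin (t + 1) → X) × X => (Λ.pt t q.1).1 :=
        measurable_subtype_coe.comp ((hptm t).comp measurable_fst)
      exact S.cost.measurable.comp
        ((measurable_fst.comp h1).prodMk ((measurable_snd.comp h1).prodMk measurable_snd))
    · rw [tailRisk_succ]
      exact S.oneStep_nonneg (hmem t h) fun y =>
        add_nonneg (S.cost_nonneg _ _ (Λ.mem t h) y) ((hbv t h).nonneg y)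
    · rw [tailRisk_succ]
      refine S.oneStep_weight_add_le hK hC.le hB (hmem t h) fun y => ?_
      have h1 : D.c (h (Fin.last t)) (Λ.toFun t h) y ≤ _ := hc (Λ.pt t h) y
      have h2 : D.tailRisk σ Λ n (t + 1) (Fin.snoc h y) ≤ B * w y := by
        simpa using ((ih (t + 1)).2 (Fin.snoc h y)).2
      rw [add_mul]
      linarith

theorem isBoundedValue_tailRisk (S : D.Standing w σ) (ht : D.UniformlyRiskTransient σ w)
    (Λ : D.Policy) (n t : ℕ) (h : Fin (t + 1) → X) :
    IsBoundedValue w fun y => D.tailRisk σ Λ n (t + 1) (Fin.snoc h y) := by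
  obtain ⟨K, hK0, hK⟩ := S.exists_oneStep_weight_le ht
  obtain ⟨B, _, hB⟩ := S.exists_tailRisk_le hK0 hK Λ n
  exact ⟨(hB (t + 1)).1.comp ((measurable_snoc t).comp measurable_prodMk_left),
    fun y => ((hB (t + 1)).2 _).1, B, fun y => by simpa using ((hB (t + 1)).2 (Fin.snoc h y)).2⟩

/-- The upper bounds for value iteration that arise from following the decision rule `π`, with the
bound `C (w(x) + w(y))` in place of the cost. -/
noncomputable def upperBound (D : Model X 𝒰) (w : X → ℝ)
    (σ : Lp ℝ p P₀ → X → DualProb p P₀ → ℝ) (π : D.Rule) (C : ℝ) : ℕ → X → ℝ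
  | 0 => 0
  | k + 1 => Set.indicator {D.xA}ᶜ fun x =>
      C * w x + D.oneStep σ (π.pt x) fun y => C * w y + upperBound D w σ π C k y

omit [TopologicalSpace X] [TopologicalSpace.MetrizableSpace X] [SecondCountableTopology X]
  [BorelSpace X] [MeasurableSpace.CountablyGenerated X] [TopologicalSpace.MetrizableSpace 𝒰]
  [SecondCountableTopology 𝒰] [BorelSpace 𝒰] [Fact (1 ≤ p)] [IsProbabilityMeasure P₀] in
theorem upperBound_absorbing (π : D.Rule) (C : ℝ) (k : ℕ) : upperBound D w σ π C k D.xA = 0 := by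
  cases k <;> simp [upperBound]

theorem isBoundedValue_upperBound (S : D.Standing w σ) (ht : D.UniformlyRiskTransient σ w)
    (π : D.Rule) {C : ℝ} (hC : 0 ≤ C) (k : ℕ) : IsBoundedValue w (upperBound D w σ π C k) := by
  obtain ⟨K, hK0, hK⟩ := S.exists_oneStep_weight_le ht
  suffices h : Measurable (upperBound D w σ π C k) ∧ (∀ x, 0 ≤ upperBound D w σ π C k x) ∧
      ∃ B : ℝ, 0 ≤ B ∧ ∀ x, upperBound D w σ π C k x ≤ B * w x from
    ⟨h.1, h.2.1, h.2.2.imp fun B hB => hB.2⟩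
  induction k with
  | zero => exact ⟨measurable_const, fun x => le_rfl, 0, le_rfl, fun x => by simp [upperBound]⟩
  | succ k ih =>
    obtain ⟨hm, h0, B, hB0, hB⟩ := ih
    have hv := S.isBoundedValue_weight_add hC ⟨hm, h0, B, hB⟩
    have hp := S.memLp hv
    have hx : ∀ x, 0 ≤ C * w x + D.oneStep σ (π.pt x) fun y => C * w y + upperBound D w σ π C k y :=
      fun x => add_nonneg (mul_nonneg hC (S.w_pos x).le) (S.oneStep_nonneg hp hv.nonneg)
    refine ⟨Measurable.indicator ((S.weight.measurable.const_mul C).add (S.measurable_oneStep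
      π.measurable_pt (hv.measurable.comp measurable_snd) fun _ => hp))
      (measurableSet_singleton _).compl, fun x => indicator_nonneg (fun x _ => hx x) x,
      C + (C + (C + B) * K), by positivity, fun x => ?_⟩
    refine (indicator_le_self' (fun x _ => hx x) x).trans ?_
    have := S.oneStep_weight_add_le hK hC hB0 (z := π.pt x) hp fun y => by
      have h1 := hB y
      have h2 : 0 ≤ C * w x := mul_nonneg hC (S.w_pos x).le
      change _ ≤ C * w x + _
      rw [add_mul]
      linarith
    change _ ≤ (C + (C + B) * K) * w x at this
    rw [add_mul]
    linarith

/-- Risk-transience bounds the iterates uniformly: each of them is a sum of integrals of the weight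
function with respect to products of selectors of the effective multikernel. -/
theorem exists_upperBound_le (S : D.Standing w σ) (ht : D.UniformlyRiskTransient σ w) (π : D.Rule)
    {C : ℝ} (hC : 0 ≤ C) : ∃ B : ℝ, ∀ k x, upperBound D w σ π C k x ≤ B * w x := by
  obtain ⟨K, hK⟩ := id ht
  have hb := S.isBoundedValue_upperBound ht π hC
  have hcb := fun k => S.isBoundedValue_weight_add hC (hb k)
  choose M hM hle using fun k => S.exists_selector_oneStep_le π (hcb k)
  -- The jump to the absorbing state adds the constant `C w(x_A) ≤ C w(x_A) w(x)`.
  set c : ℝ := C + C * w D.xA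
  have hcA : 0 ≤ C * w D.xA := mul_nonneg hC (S.w_pos _).le
  have hc0 : 0 ≤ c := add_nonneg hC hcA
  have hrec : ∀ k (x : {x : X // x ≠ D.xA}),
      ENNReal.ofReal (upperBound D w σ π C (k + 1) x.1) ≤
        ENNReal.ofReal c * ENNReal.ofReal (w x.1) + ∫⁻ y, (ENNReal.ofReal c * ENNReal.ofReal (w y.1)
          + ENNReal.ofReal (upperBound D w σ π C k y.1)) ∂M k x := fun k x => by
    have hx : upperBound D w σ π C (k + 1) x.1 = C * w x.1 + D.oneStep σ (π.pt x.1) fun y =>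
        C * w y + upperBound D w σ π C k y := by
      rw [upperBound, indicator_of_mem (show x.1 ∈ ({D.xA} : Set X)ᶜ from x.2)]
    have hCx : 0 ≤ C * w x.1 := mul_nonneg hC (S.w_pos _).le
    rw [hx, ENNReal.ofReal_add hCx (S.oneStep_nonneg (S.memLp (hcb k)) (hcb k).nonneg)]
    refine (add_le_add_right (hle k x) _).trans ?_
    rw [upperBound_absorbing, add_zero, ← add_assoc, ← ENNReal.ofReal_add hCx hcA,
      ← ENNReal.ofReal_mul hc0]
    refine add_le_add (ENNReal.ofReal_le_ofReal ?_) (lintegral_mono fun y => ?_)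
    · have := le_mul_of_one_le_right hcA (S.weight.one_le x.1)
      simp only [c, add_mul]
      linarith
    · rw [← ENNReal.ofReal_mul hc0, ← ENNReal.ofReal_add (mul_nonneg hc0 (S.w_pos _).le)
        ((hb k).nonneg _)]
      refine ENNReal.ofReal_le_ofReal (add_le_add_left ?_ _)
      exact mul_le_mul_of_nonneg_right (le_add_of_nonneg_right hcA) (S.w_pos _).le
  have hsum := le_sum_lintegral_kernelProd
    (W := fun x : {x : X // x ≠ D.xA} => ENNReal.ofReal (w x.1))
    (S.weight.measurable.comp measurable_subtype_coe).ennreal_ofReal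
    (β := fun k x => ENNReal.ofReal (upperBound D w σ π C k x.1)) (fun x => by simp [upperBound])
    hrec
  refine ⟨c + 2 * c * K, fun k x => ?_⟩
  have hB0 : 0 ≤ c + 2 * c * K := by positivity
  by_cases hx : x = D.xA
  · rw [hx, upperBound_absorbing]
    exact mul_nonneg hB0 (S.w_pos _).le
  have hN : ∀ i, IsSelector (M (k - 1 - i)) (D.effMultikernel σ π) := fun i => hM _
  have h1 := S.lintegral_weight_le (hK π k _ (isSelector_sum_kernelProd hN k)) ⟨x, hx⟩
  rw [sum_apply, lintegral_finsetSum_measure] at h1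
  have h2 := (hsum k ⟨x, hx⟩).trans (add_le_add_right (mul_le_mul_right h1 _) _)
  rw [← ENNReal.ofReal_coe_nnreal, ← ENNReal.ofReal_ofNat, ← ENNReal.ofReal_mul hc0,
    ← ENNReal.ofReal_mul zero_le_two, ← ENNReal.ofReal_mul K.coe_nonneg,
    ← ENNReal.ofReal_mul (show 0 ≤ 2 * c by positivity),
    ← ENNReal.ofReal_add (mul_nonneg hc0 (S.w_pos _).le)
      (mul_nonneg (by positivity) (mul_nonneg K.coe_nonneg (S.w_pos _).le)),
    ENNReal.ofReal_le_ofReal_iff (add_nonneg (mul_nonneg hc0 (S.w_pos _).le)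
      (mul_nonneg (by positivity) (mul_nonneg K.coe_nonneg (S.w_pos _).le)))] at h2
  rw [add_mul, mul_assoc]
  exact h2

/-- Value iteration stays below a fixed multiple of the weight function. -/
theorem exists_valueIter_le (S : D.Standing w σ) (ht : D.UniformlyRiskTransient σ w) :
    ∃ B : ℝ, ∀ k, IsBoundedValue w (D.valueIter σ k) ∧ ∀ x, D.valueIter σ k x ≤ B * w x := by
  obtain ⟨π⟩ := S.nonempty_rule
  obtain ⟨C, hC, hc⟩ := S.exists_cost_le
  obtain ⟨B, hB⟩ := S.exists_upperBound_le ht π hC.le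
  suffices h : ∀ k, Measurable (D.valueIter σ k) ∧ (∀ x, 0 ≤ D.valueIter σ k x) ∧
      ∀ x, D.valueIter σ k x ≤ upperBound D w σ π C k x from
    ⟨B, fun k => ⟨⟨(h k).1, (h k).2.1, B, fun x => ((h k).2.2 x).trans (hB k x)⟩,
      fun x => ((h k).2.2 x).trans (hB k x)⟩⟩
  intro k
  induction k with
  | zero => exact ⟨measurable_const, fun x => le_rfl, fun x => le_rfl⟩
  | succ k ih =>
    have hv : IsBoundedValue w (D.valueIter σ k) :=
      ⟨ih.1, ih.2.1, B, fun x => (ih.2.2 x).trans (hB k x)⟩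
    have hdp := S.exists_rule_dpOp hv
    refine ⟨hdp.1, S.dpOp_nonneg hv, fun x => (hdp.2.1 (π.pt x)).trans ?_⟩
    have hp := S.memLp_cost_add (π.pt x) (S.memLp hv)
    by_cases hx : x = D.xA
    · rw [hx] at hp ⊢
      rw [S.oneStep_absorbing (z := π.pt D.xA) rfl hp, upperBound_absorbing]
      have h1 := ih.2.2 D.xA
      rw [upperBound_absorbing] at h1
      have h2 : D.c (π.pt D.xA).1.1 (π.pt D.xA).1.2 D.xA = 0 := D.c_absorbing _ (π.mem D.xA)
      rw [h2, zero_add]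
      exact h1
    · have hb := S.memLp (S.isBoundedValue_weight_add hC.le
        (S.isBoundedValue_upperBound ht π hC.le k))
      rw [upperBound, indicator_of_mem (show x ∈ ({D.xA} : Set X)ᶜ from hx),
        ← S.oneStep_const_add hb]
      refine S.oneStep_mono hp ((memLp_const (C * w x)).add hb) fun y => ?_
      have h1 : D.c (π.pt x).1.1 (π.pt x).1.2 y ≤ C * w x + C * w y := hc (π.pt x) y
      have h2 := ih.2.2 y
      linarith

/-! ### Value iteration and the optimal value -/

theorem monotone_valueIter (S : D.Standing w σ) (ht : D.UniformlyRiskTransient σ w) (x : X) :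
    Monotone fun k => D.valueIter σ k x := by
  obtain ⟨B, hB⟩ := S.exists_valueIter_le ht
  refine monotone_nat_of_le_succ fun k => ?_
  induction k generalizing x with
  | zero => exact (hB 1).1.nonneg x
  | succ k ih => exact S.dpOp_mono (hB k).1 (hB (k + 1)).1 ih x

/-- Every policy does at least as badly over `n` periods as value iteration. -/
theorem valueIter_le_tailRisk (S : D.Standing w σ) (ht : D.UniformlyRiskTransient σ w)
    (Λ : D.Policy) (n t : ℕ) (h : Fin (t + 1) → X) :
    D.valueIter σ n (h (Fin.last t)) ≤ D.tailRisk σ Λ n t h := by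
  obtain ⟨B, hB⟩ := S.exists_valueIter_le ht
  induction n generalizing t with
  | zero => exact le_rfl
  | succ n ih =>
    rw [tailRisk_succ]
    refine ((S.exists_rule_dpOp (hB n).1).2.1 (Λ.pt t h)).trans
      (S.oneStep_mono (S.memLp_cost_add _ (S.memLp (hB n).1)) (S.memLp_cost_add (Λ.pt t h)
        (S.memLp (S.isBoundedValue_tailRisk ht Λ n t h))) fun y => add_le_add_right ?_ _)
    simpa using ih (t + 1) (Fin.snoc h y)

/-- If the decision rule `π` does not increase `g`, then its risk over every finite horizon is at
most `g`. -/
theorem tailRisk_ofRules_le (S : D.Standing w σ) (ht : D.UniformlyRiskTransient σ w) {g : X → ℝ}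
    (hg : IsBoundedValue w g) {π : D.Rule}
    (hπ : ∀ x, (D.oneStep σ (π.pt x) fun y => D.c x (π.toFun x) y + g y) ≤ g x) (n t : ℕ)
    (h : Fin (t + 1) → X) :
    D.tailRisk σ (Policy.ofRules fun _ => π) n t h ≤ g (h (Fin.last t)) := by
  induction n generalizing t with
  | zero => exact hg.nonneg _
  | succ n ih =>
    rw [tailRisk_succ]
    refine le_trans (S.oneStep_mono (S.memLp_cost_add (π.pt (h (Fin.last t)))
      (S.memLp (S.isBoundedValue_tailRisk ht _ n t h)))
      (S.memLp_cost_add (π.pt (h (Fin.last t))) (S.memLp hg)) fun y => add_le_add_right ?_ _)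
      (hπ (h (Fin.last t)))
    simpa using ih (t + 1) (Fin.snoc h y)

/-- The limit `g` of value iteration is the optimal value: no policy has a smaller risk, and the
stationary policy of a minimizer in `𝔇 g` has risk at most `g`. -/
theorem exists_value (S : D.Standing w σ) (ht : D.UniformlyRiskTransient σ w) :
    ∃ g : X → ℝ, IsBoundedValue w g ∧
      (∀ x, Tendsto (fun k => D.valueIter σ k x) atTop (𝓝 (g x))) ∧
      ∀ x, D.JStar σ x ≤ g x ∧ (g x : EReal) ≤ D.JHat σ x := by
  obtain ⟨B, hB⟩ := S.exists_valueIter_le ht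
  have hmono := S.monotone_valueIter ht
  have hbdd : ∀ x, BddAbove (range fun k => D.valueIter σ k x) := fun x =>
    ⟨B * w x, by rintro _ ⟨k, rfl⟩; exact (hB k).2 x⟩
  have hlim : ∀ x, Tendsto (fun k => D.valueIter σ k x) atTop (𝓝 (⨆ k, D.valueIter σ k x)) :=
    fun x => tendsto_atTop_ciSup (hmono x) (hbdd x)
  have hg : IsBoundedValue w fun x => ⨆ k, D.valueIter σ k x :=
    ⟨Measurable.iSup fun k => (hB k).1.measurable,
      fun x => ge_of_tendsto' (hlim x) fun k => (hB k).1.nonneg x,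
      B, fun x => le_of_tendsto' (hlim x) fun k => (hB k).2 x⟩
  refine ⟨_, hg, hlim, fun x => ⟨?_, le_iInf fun Λ => ?_⟩⟩
  · obtain ⟨_, _, π, hπ⟩ := S.exists_rule_dpOp hg
    refine iInf_le_of_le π ?_
    have hle := S.tailRisk_ofRules_le ht hg (π := π) fun x => (hπ x).trans_le
      (S.dpOp_le_of_tendsto (fun k => (hB k).1) hg hmono hlim fun k =>
        (hmono x).ge_of_tendsto (hlim x) (k + 1))
    refine (liminf_le_liminf (v := fun _ => ((⨆ k, D.valueIter σ k x : ℝ) : EReal))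
      (Eventually.of_forall fun T => EReal.coe_le_coe_iff.2 (hle T 0 fun _ => x))).trans_eq ?_
    exact liminf_const _
  · have h1 : Tendsto (fun k => ((D.valueIter σ k x : ℝ) : EReal)) atTop
        (𝓝 ((⨆ k, D.valueIter σ k x : ℝ) : EReal)) :=
      (continuous_coe_real_ereal.tendsto _).comp (hlim x)
    rw [← h1.liminf_eq]
    exact liminf_le_liminf (Eventually.of_forall fun T =>
      EReal.coe_le_coe_iff.2 (S.valueIter_le_tailRisk ht Λ T 0 fun _ => x))

end Standing

end RiskMDP.Model

/-! ### The value iteration theorem -/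

theorem mainTheorem6
    {X 𝒰 : Type*}
    [TopologicalSpace X] [TopologicalSpace.MetrizableSpace X] [SecondCountableTopology X]
    [MeasurableSpace X] [BorelSpace X] [StandardBorelSpace X]
    [TopologicalSpace 𝒰] [TopologicalSpace.MetrizableSpace 𝒰] [SecondCountableTopology 𝒰]
    [MeasurableSpace 𝒰] [BorelSpace 𝒰] [StandardBorelSpace 𝒰]
    (D : RiskMDP.Model X 𝒰)
    (p : ℝ≥0∞) [Fact (1 ≤ p)] (hp : p ≠ ∞)
    (P₀ : Measure X) [IsProbabilityMeasure P₀]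
    (w : X → ℝ) (hw : RiskMDP.IsWeight p P₀ w)
    (σ : Lp ℝ p P₀ → X → RiskMDP.DualProb p P₀ → ℝ)
    (hσ : RiskMDP.IsRiskTransitionMapping σ) (hlaw : RiskMDP.LawInvariant σ)
    (hG0 : D.CondG0 p P₀) (hG1 : D.CondG1)
    (hG2 : RiskMDP.RiskSetLowerSemicontinuous σ)
    (hG3 : D.CondG3 w) (hG4 : D.CondG4)
    (hcont : ∀ x, SeqContinuous
      (fun z : Lp ℝ p P₀ × RiskMDP.DualProb p P₀ => σ z.1 x z.2))
    (hc : ∀ x, ∀ u ∈ D.U x, ∀ y, 0 ≤ D.c x u y)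
    (htrans : D.UniformlyRiskTransient σ w) :
    -- the nested risk evaluations are well defined
    (∀ (Λ : D.Policy) (n t : ℕ) (h : Fin (t + 1) → X),
      MemLp (fun y => D.stageCost Λ t (Fin.snoc h y)
        + D.tailRisk σ Λ n (t + 1) (Fin.snoc h y)) p P₀) ∧
    -- value iteration is well defined: the iterates lie in `V` and the minima are attained
    (∀ k, Measurable (D.valueIter σ k) ∧ MemLp (D.valueIter σ k) p P₀ ∧
      ∀ x, IsLeast (Set.range (D.stepRisk σ (D.valueIter σ k) x)) (D.valueIter σ (k + 1) x)) ∧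
    -- pointwise convergence to `Ĵ`
    (∀ x, Tendsto (fun k => ((D.valueIter σ k x : ℝ) : EReal)) atTop (𝓝 (D.JHat σ x))) ∧
    -- `Ĵ` lies in `V`
    (∃ g : X → ℝ, Measurable g ∧ MemLp g p P₀ ∧ ∀ x, D.JHat σ x = (g x : EReal)) ∧
    -- Markov, and even stationary Markov, policies achieve the same infimum
    (∀ x, D.JMarkov σ x = D.JHat σ x ∧ D.JStar σ x = D.JHat σ x) := by
  have S : D.Standing w σ :=
    { ne_top := hp, weight := hw, coherent := hσ.coherent
      continuous := fun x m => continuous_iff_seqContinuous.2 fun _ _ hu =>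
        hcont x (((Continuous.prodMk_left m).tendsto _).comp hu)
      law := hlaw, dual := hG0, setwise := hG1, riskSet_lsc := hG2, cost := hG3, compact := hG4
      cost_nonneg := hc }
  obtain ⟨B, hB⟩ := S.exists_valueIter_le htrans
  obtain ⟨g, hg, hlim, hJ⟩ := S.exists_value htrans
  have hHM : ∀ x, D.JHat σ x ≤ D.JMarkov σ x := fun x => le_iInf fun π => iInf_le _ _
  have hMS : ∀ x, D.JMarkov σ x ≤ D.JStar σ x := fun x => le_iInf fun π => iInf_le _ fun _ => π
  have hJg : ∀ x, D.JHat σ x = g x := fun x =>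
    le_antisymm (((hHM x).trans (hMS x)).trans (hJ x).1) (hJ x).2
  refine ⟨fun Λ n t h => ?_, fun k => ⟨(hB k).1.measurable, S.memLp (hB k).1, fun x => ?_⟩,
    fun x => ?_, ⟨g, hg.measurable, S.memLp hg, hJg⟩, fun x => ⟨?_, ?_⟩⟩
  · simp only [RiskMDP.Model.stageCost, Fin.init_snoc, Fin.snoc_castSucc, Fin.snoc_last]
    exact S.memLp_cost_add (Λ.pt t h) (S.memLp (S.isBoundedValue_tailRisk htrans Λ n t h))
  · obtain ⟨_, hle, π, hπ⟩ := S.exists_rule_dpOp (hB k).1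
    refine ⟨⟨⟨π.toFun x, π.mem x⟩, hπ x⟩, ?_⟩
    rintro _ ⟨u, rfl⟩
    exact hle ⟨(x, u), u.2⟩
  · rw [hJg]
    exact (continuous_coe_real_ereal.tendsto _).comp (hlim x)
  · exact le_antisymm ((hMS x).trans ((hJ x).1.trans_eq (hJg x).symm)) (hHM x)
  · exact le_antisymm ((hJ x).1.trans_eq (hJg x).symm) ((hHM x).trans (hMS x))
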